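/- Let $r\ge 1$, let $\mu_r\subset\mathbb{C}^\times$ be the group of $r$th roots of unity, and let $\mathcal{A}_r=\mathbb{Q}\langle x,y_s\mid s\in\mu_r\rangle$ be the noncommutative polynomial algebra. Put $y=y_1$, $z=x+y$, $z_s=x+y_s$, $\delta(1)=0$, $\delta(s)=1$ for $s\ne 1$, $z_s^\delta=x+\delta(s)y_s$, and $\mathcal{A}_1^1=\mathbb{Q}\oplus\mathcal{A}_1y\subset\mathcal{A}_1=\mathbb{Q}\langle x,y\rangle\subset\mathcal{A}_r$. *Diamond product.* Let $\varphi$ be the automorphism of $\mathcal{A}_r$ with $\varphi(x)=z$, $\varphi(y_s)=z_s^\delta-z$. With $z_{k,s}=x^{k-1}y_s$, let $\mathcal{I}$ and $M_s$ $(s\in\mu_r)$ be the $\mathbb{Q}$-linear maps on $\mathcal{A}_r$ with $\mathcal{I}(z_{k_1,s_1}\cdots z_{k_l,s_l}x^a)=z_{k_1,s_1}z_{k_2,s_1s_2}\cdots z_{k_l,s_1\cdots s_l}x^a$ and $M_s(z_{k_1,s_1}\cdots z_{k_l,s_l}x^a)=z_{k_1,ss_1}z_{k_2,s_2}\cdots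 z_{k_l,s_l}x^a$, and put $\psi_s=\varphi\mathcal{I}M_s$. The $\mathbb{Q}$-bilinear map $\diamond_s:\mathcal{A}_1\times\mathcal{A}_r\to\mathcal{A}_r$ is defined by $1\diamond_s w=w$, $v\diamond_s 1=\psi_s\varphi(v)$ and, for $v\in\mathcal{A}_1$, $w\in\mathcal{A}_r$, $1\ne t\in\mu_r$, $$\begin{aligned} vx\diamond_s wx&=(v\diamond_s wx)x-(vy\diamond_s w)x, & vy\diamond_s wx&=(v\diamond_s wx)y+(vy\diamond_s w)x,\\ vx\diamond_s wy&=(v\diamond_s wy)x+(vx\diamond_s w)y, & vy\diamond_s wy&=(v\diamond_s wy)y-(vx\diamond_s w)y,\\ vx\diamond_s wy_t&=(v\diamond_s wy_t)x+(v\diamond_s wz_t)y_t-(vy\diamond_s w)y_t, & vy\diamond_s wy_t&=(v\diamond_s wy_t)y-(v\diamond_s wz_t)y_t+(vy\diamond_s w)y_t. \end{aligned}$$ *Hopf algebra.* Let $\mathcal{H}$ be the Connes–Kreimer Hopf algebra: the commutative $\mathbb{Q}$-algebra freely generated by the (non-planar) rooted trees, so that the rooted forests form a $\mathbb{Q}$-basis,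 the empty forest $\mathbb{I}$ being the unit. Let $B_+$ be the $\mathbb{Q}$-linear map that sends a forest to the rooted tree obtained by joining all its roots to one new root. The coproduct $\Delta$ is the algebra homomorphism with $\Delta(B_+(f))=B_+(f)\otimes\mathbb{I}+(\mathrm{id}\otimes B_+)\Delta(f)$ for every forest $f$, the counit is $1$ on $\mathbb{I}$ and $0$ on all other forests, and $S$ is the antipode. *Rooted tree maps.* Let $R_w(v)=vw$. The rooted tree maps are given by the $\mathbb{Q}$-linear assignment $\mathcal{H}\to\mathrm{End}_{\mathbb{Q}}(\mathcal{A}_r)$, $f\mapsto\widetilde f$, with $\widetilde{\mathbb{I}}=\mathrm{id}$ that satisfies, for all $s\in\mu_r$: (I) $\widetilde{\bullet}(z_s^\delta)=z_s^\delta(z-z_s^\delta)$ and $\widetilde{\bullet}(z)=0$, where $\bullet=B_+(\mathbb{I})$; (II) for every forest $f\neq\mathbb{I}$, $\widetilde f(z_s^\delta)\in\mathcal{A}_r(z-z_s^\delta)$, $\widetilde{B_+(f)}(z_s^\delta)=R_{z-z_s^\delta}R_{2z-z_s^\delta}R_{z-z_s^\delta}^{-1}\widetilde f(z_s^\delta)$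 and $\widetilde{B_+(f)}(z)=0$; (III) for all forests $g,h$, $\widetilde{gh}(v)=\widetilde g(\widetilde h(v))$ for $v\in\{z\}\cup\{z_t^\delta\mid t\in\mu_r\}$; (IV) for every forest $f$ with $\Delta(f)=\sum a\otimes b$, $\widetilde f(wv)=\sum\widetilde a(w)\,\widetilde b(v)$ for $w\in\mathcal{A}_r$ and $v\in\{z\}\cup\{z_t^\delta\mid t\in\mu_r\}$. **Theorem.** There is exactly one such assignment $f\mapsto\widetilde f$, and for every $f\in\mathcal{H}$ there exists a unique $G_f\in\mathcal{A}_1^1$ such that $$\widetilde{S(f)}(z_s^\delta w)=z_s^\delta\,(G_f\diamond_s w)$$ holds for all $s\in\mu_r$ and all $w\in\mathcal{A}_r$. -/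

import Mathlib

open scoped TensorProduct

namespace RootedTreeMaps

noncomputable section

/-! ### Rooted trees -/

/-- Finite multisets as a quotient of the polynomial functor of finite sequences. -/
instance multisetQPF : QPF Multiset where
  P := ⟨ℕ, Fin⟩
  abs := fun p => (List.ofFn p.2 : Multiset _)
  repr := fun m => ⟨m.toList.length, m.toList.get⟩
  abs_repr := fun m => by
    change ((List.ofFn m.toList.get : List _) : Multiset _) = m
    rw [List.ofFn_get, Multiset.coe_toList]
  abs_map := fun f p => by
    obtain ⟨n, g⟩ := p
    simp [PFunctor.map, Multiset.fmap_def, List.map_ofFn]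

/-- (Non-planar) rooted trees: the initial algebra of the functor of finite multisets.
A rooted tree is the same thing as the finite multiset of the rooted trees that hang
below its root. -/
def RootedTree : Type := QPF.Fix Multiset

/-- The rooted tree obtained by joining the roots of the trees of a rooted forest (a finite
multiset of rooted trees) to a single new root.  The tree `graft 0` has one vertex. -/
def graft (f : Multiset RootedTree) : RootedTree := QPF.Fix.mk f

/-- The forest that remains when the root of a tree is removed. -/
def branches (t : RootedTree) : Multiset RootedTree := QPF.Fix.dest t

theorem branches_graft (f : Multiset RootedTree) : branches (graft f) = f :=
  QPF.Fix.dest_mk (F := Multiset) f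

theorem graft_branches (t : RootedTree) : graft (branches t) = t :=
  QPF.Fix.mk_dest (F := Multiset) t

theorem RootedTree.induction {p : RootedTree → Prop}
    (h : ∀ f : Multiset RootedTree, (∀ t ∈ f, p t) → p (graft f)) (t : RootedTree) : p t := by
  refine QPF.Fix.ind (F := Multiset) p (fun f hf => h f ?_) t
  obtain ⟨a, g, rfl, hg⟩ := (QPF.liftp_iff p f).1 hf
  intro t ht
  have ht' : t ∈ List.ofFn g := ht
  obtain ⟨i, rfl⟩ := (List.mem_ofFn' _ _).1 ht'
  exact hg i

/-- Recursion on rooted trees. -/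
def RootedTree.fold {α : Type} (g : Multiset α → α) : RootedTree → α :=
  QPF.Fix.rec (F := Multiset) g

theorem RootedTree.fold_graft {α : Type} (g : Multiset α → α) (f : Multiset RootedTree) :
    RootedTree.fold g (graft f) = g (f.map (RootedTree.fold g)) :=
  QPF.Fix.rec_eq (F := Multiset) g f

/-! ### The Connes–Kreimer Hopf algebra -/

/-- The commutative `ℚ`-algebra freely generated by the rooted trees; the rooted forests
(monomials) form a basis of it, and the empty forest is `1`. -/
def CK : Type := MvPolynomial RootedTree ℚ

instance : CommRing CK := inferInstanceAs (CommRing (MvPolynomial RootedTree ℚ))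

instance : Algebra ℚ CK := inferInstanceAs (Algebra ℚ (MvPolynomial RootedTree ℚ))

/-- A rooted tree as an element of the algebra. -/
def tree (t : RootedTree) : CK := MvPolynomial.X (R := ℚ) t

/-- A rooted forest as an element of the algebra: the product of its trees. -/
def forest (f : Multiset RootedTree) : CK := (f.map tree).prod

/-- The algebra homomorphism with prescribed values on rooted trees. -/
def liftTree {B : Type} [CommRing B] [Algebra ℚ B] (g : RootedTree → B) : CK →ₐ[ℚ] B :=
  MvPolynomial.aeval (R := ℚ) g

theorem liftTree_tree {B : Type} [CommRing B] [Algebra ℚ B] (g : RootedTree → B)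
    (t : RootedTree) : liftTree g (tree t) = g t :=
  MvPolynomial.aeval_X (R := ℚ) g t

theorem algHom_ext {B : Type} [CommRing B] [Algebra ℚ B] {φ ψ : CK →ₐ[ℚ] B}
    (h : ∀ t, φ (tree t) = ψ (tree t)) : φ = ψ :=
  MvPolynomial.algHom_ext (R := ℚ) (σ := RootedTree) h

theorem map_forest {B : Type} [CommRing B] [Algebra ℚ B] (φ : CK →ₐ[ℚ] B)
    (f : Multiset RootedTree) : φ (forest f) = (f.map fun t => φ (tree t)).prod := by
  simp [forest, map_multiset_prod, Multiset.map_map]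

/-- The identification with polynomials in variables indexed by rooted trees. -/
def toMv : CK ≃ₐ[ℚ] MvPolynomial RootedTree ℚ :=
  AlgEquiv.refl (R := ℚ) (A₁ := MvPolynomial RootedTree ℚ)

open Classical in
/-- The basis of rooted forests. -/
def forestBasis : Module.Basis (Multiset RootedTree) ℚ CK :=
  ((MvPolynomial.basisMonomials RootedTree ℚ).map toMv.symm.toLinearEquiv).reindex
    Multiset.toFinsupp.symm.toEquiv

theorem forestBasis_apply (f : Multiset RootedTree) : forestBasis f = forest f := by
  classical
  have h : forestBasis f = toMv.symm (MvPolynomial.monomial (Multiset.toFinsupp f) (1 : ℚ)) := by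
    rw [forestBasis, Module.Basis.reindex_apply, Module.Basis.map_apply,
      MvPolynomial.coe_basisMonomials]
    simp
  rw [h]
  clear h
  induction f using Multiset.induction_on with
  | empty => simp [forest]
  | cons a s ih =>
    have : forest (a ::ₘ s) = tree a * forest s := by simp [forest]
    have h' : tree a = toMv.symm (MvPolynomial.monomial (Finsupp.single a 1) (1 : ℚ)) := rfl
    rw [this, ← ih, ← Multiset.singleton_add, map_add, Multiset.toFinsupp_singleton, h',
      ← map_mul, MvPolynomial.monomial_mul, one_mul]

/-- The grafting operator `B₊`: the linear map that sends a rooted forest `f` to the rooted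
tree `graft f`. -/
def Bplus : CK →ₗ[ℚ] CK := forestBasis.constr ℚ fun f => tree (graft f)

theorem Bplus_forest (f : Multiset RootedTree) : Bplus (forest f) = tree (graft f) := by
  rw [← forestBasis_apply, Bplus, Module.Basis.constr_basis]

/-- The coproduct of a tree, by the recursion
`Δ (B₊ f) = B₊ f ⊗ 1 + (id ⊗ B₊) (Δ f)`, where `Δ f` is the product of the coproducts of the
trees of `f`.  The recursion keeps the tree itself as first component. -/
def comulTree (t : RootedTree) : CK ⊗[ℚ] CK :=
  (RootedTree.fold (α := RootedTree × (CK ⊗[ℚ] CK))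
    (fun m => (graft (m.map Prod.fst),
      tree (graft (m.map Prod.fst)) ⊗ₜ 1 + Bplus.lTensor CK (m.map Prod.snd).prod)) t).2

/-- The coproduct `Δ`: the algebra homomorphism given by `comulTree` on trees. -/
def comulHom : CK →ₐ[ℚ] CK ⊗[ℚ] CK := liftTree comulTree

theorem comulHom_tree_graft (f : Multiset RootedTree) :
    comulHom (tree (graft f)) =
      tree (graft f) ⊗ₜ 1 + Bplus.lTensor CK (comulHom (forest f)) := by
  have key : ∀ t, (RootedTree.fold (α := RootedTree × (CK ⊗[ℚ] CK))
    (fun m => (graft (m.map Prod.fst),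
      tree (graft (m.map Prod.fst)) ⊗ₜ 1 + Bplus.lTensor CK (m.map Prod.snd).prod)) t).1 = t := by
    intro t
    induction t using RootedTree.induction with
    | h f ih =>
      rw [RootedTree.fold_graft]
      simp only [Multiset.map_map, Function.comp_def]
      rw [Multiset.map_congr rfl (fun t ht => ih t ht), Multiset.map_id']
  rw [map_forest]
  simp only [comulHom, liftTree_tree]
  rw [comulTree, RootedTree.fold_graft]
  simp only [Multiset.map_map, Function.comp_def]
  simp only [key, Multiset.map_id']
  rfl

/-- The cocycle property of the grafting operator. -/
theorem comulHom_Bplus (a : CK) :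
    comulHom (Bplus a) = Bplus a ⊗ₜ 1 + Bplus.lTensor CK (comulHom a) := by
  have h : comulHom.toLinearMap ∘ₗ Bplus =
      (TensorProduct.mk ℚ CK CK).flip 1 ∘ₗ Bplus + Bplus.lTensor CK ∘ₗ comulHom.toLinearMap := by
    refine forestBasis.ext fun f => ?_
    simp [forestBasis_apply, Bplus_forest, comulHom_tree_graft]
  exact LinearMap.congr_fun h a

/-- The counit: it is `1` on the empty forest and vanishes on all other forests. -/
def counitHom : CK →ₐ[ℚ] ℚ := liftTree fun _ => 0

theorem counitHom_Bplus (a : CK) : counitHom (Bplus a) = 0 := by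
  have h : counitHom.toLinearMap ∘ₗ Bplus = 0 := by
    refine forestBasis.ext fun f => ?_
    simp [forestBasis_apply, Bplus_forest, counitHom, liftTree_tree]
  exact LinearMap.congr_fun h a

theorem forest_congr {B : Type} [CommRing B] [Algebra ℚ B] {φ ψ : CK →ₐ[ℚ] B}
    {f : Multiset RootedTree} (h : ∀ t ∈ f, φ (tree t) = ψ (tree t)) :
    φ (forest f) = ψ (forest f) := by
  rw [map_forest, map_forest, Multiset.map_congr rfl h]

theorem coassocHom :
    (Algebra.TensorProduct.assoc ℚ ℚ ℚ CK CK CK).toAlgHom.comp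
      ((Algebra.TensorProduct.map comulHom (.id ℚ CK)).comp comulHom)
      = (Algebra.TensorProduct.map (.id ℚ CK) comulHom).comp comulHom := by
  refine algHom_ext fun t => ?_
  induction t using RootedTree.induction with
  | h f ih =>
    have hf := forest_congr ih
    simp only [AlgHom.comp_apply] at hf ⊢
    have h1 : ∀ z : CK ⊗[ℚ] CK,
        (Algebra.TensorProduct.assoc ℚ ℚ ℚ CK CK CK).toAlgHom
          (Algebra.TensorProduct.map comulHom (.id ℚ CK) (Bplus.lTensor CK z)) =
        (Bplus.lTensor CK).lTensor CK ((Algebra.TensorProduct.assoc ℚ ℚ ℚ CK CK CK).toAlgHom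
          (Algebra.TensorProduct.map comulHom (.id ℚ CK) z)) := by
      intro z
      induction z with
      | zero => simp
      | add x y hx hy => simp only [map_add, hx, hy]
      | tmul a b =>
        simp only [LinearMap.lTensor_tmul, Algebra.TensorProduct.map_tmul]
        generalize comulHom a = c
        induction c with
        | zero => simp
        | add x y hx hy => simp only [map_add, hx, hy, TensorProduct.add_tmul]
        | tmul p q => simp
    have h2 : ∀ z : CK ⊗[ℚ] CK,
        Algebra.TensorProduct.map (.id ℚ CK) comulHom (Bplus.lTensor CK z) =
        (Algebra.TensorProduct.assoc ℚ ℚ ℚ CK CK CK).toAlgHom (Bplus.lTensor CK z ⊗ₜ 1) +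
        (Bplus.lTensor CK).lTensor CK
          (Algebra.TensorProduct.map (.id ℚ CK) comulHom z) := by
      intro z
      induction z with
      | zero => simp
      | add x y hx hy =>
        simp only [map_add, hx, hy, TensorProduct.add_tmul]
        abel
      | tmul a b => simp [comulHom_Bplus, TensorProduct.tmul_add]
    rw [comulHom_tree_graft]
    simp only [map_add, h1, h2, hf, Algebra.TensorProduct.map_tmul, comulHom_tree_graft,
      TensorProduct.add_tmul, map_one]
    simp [Algebra.TensorProduct.one_def, add_assoc]

instance : Bialgebra ℚ CK :=
  Bialgebra.ofAlgHom comulHom counitHom coassocHom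
    (by
      refine algHom_ext fun t => ?_
      induction t using RootedTree.induction with
      | h f ih =>
        have hf := forest_congr ih
        simp only [AlgHom.comp_apply] at hf ⊢
        have h1 : ∀ z : CK ⊗[ℚ] CK,
            Algebra.TensorProduct.map counitHom (.id ℚ CK) (Bplus.lTensor CK z) =
            Bplus.lTensor ℚ (Algebra.TensorProduct.map counitHom (.id ℚ CK) z) := by
          intro z
          induction z with
          | zero => simp
          | add x y hx hy => simp only [map_add, hx, hy]
          | tmul a b => simp
        rw [comulHom_tree_graft, map_add, h1, hf]
        simp [counitHom, liftTree_tree, Bplus_forest])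
    (by
      refine algHom_ext fun t => ?_
      have h1 : ∀ z : CK ⊗[ℚ] CK,
          Algebra.TensorProduct.map (.id ℚ CK) counitHom (Bplus.lTensor CK z) = 0 := by
        intro z
        induction z with
        | zero => simp
        | add x y hx hy => simp only [map_add, hx, hy, add_zero]
        | tmul a b => simp [counitHom_Bplus]
      rw [AlgHom.comp_apply, ← graft_branches t, comulHom_tree_graft, map_add, h1]
      simp)

/-- `(S ⊗ id) (Δ t)` for a tree `t` and the antipode `S`, by recursion on `t`: if `P` is
`(id ⊗ B₊)` applied to the product of the values at the branches of `t`, then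
`(S ⊗ id) (Δ t) = S t ⊗ 1 + P`, and `S t` has to be `-m P`. -/
def antipodeComulTree : RootedTree → CK ⊗[ℚ] CK :=
  RootedTree.fold fun m =>
    -(LinearMap.mul' ℚ CK (Bplus.lTensor CK m.prod)) ⊗ₜ 1 + Bplus.lTensor CK m.prod

/-- The antipode, as the algebra homomorphism with
`S t = -m ((S ⊗ B₊) (Δ f))` for `t = B₊ f`. -/
def antipodeHom : CK →ₐ[ℚ] CK :=
  liftTree fun t =>
    -(LinearMap.mul' ℚ CK (Bplus.lTensor CK ((branches t).map antipodeComulTree).prod))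

theorem antipodeHom_rTensor_comul (t : RootedTree) :
    Algebra.TensorProduct.map antipodeHom (.id ℚ CK) (comulHom (tree t)) =
      antipodeComulTree t := by
  induction t using RootedTree.induction with
  | h f ih =>
    have h1 : ∀ z : CK ⊗[ℚ] CK,
        Algebra.TensorProduct.map antipodeHom (.id ℚ CK) (Bplus.lTensor CK z) =
        Bplus.lTensor CK (Algebra.TensorProduct.map antipodeHom (.id ℚ CK) z) := by
      intro z
      induction z with
      | zero => simp
      | add x y hx hy => simp only [map_add, hx, hy]
      | tmul a b => simp
    have h2 : Algebra.TensorProduct.map antipodeHom (.id ℚ CK) (comulHom (forest f)) =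
        (f.map antipodeComulTree).prod := by
      rw [← AlgHom.comp_apply, map_forest]
      exact congrArg _ (Multiset.map_congr rfl ih)
    rw [comulHom_tree_graft, map_add, h1, h2, antipodeComulTree, RootedTree.fold_graft,
      Algebra.TensorProduct.map_tmul, antipodeHom, liftTree_tree, branches_graft]
    rw [map_one]
    rfl

open WithConv in
theorem antipodeHom_left :
    toConv antipodeHom * toConv (AlgHom.id ℚ CK) = (1 : WithConv (CK →ₐ[ℚ] CK)) := by
  refine WithConv.ext (algHom_ext fun t => ?_)
  change LinearMap.mul' ℚ CK
    (Algebra.TensorProduct.map antipodeHom (.id ℚ CK) (comulHom (tree t))) =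
      algebraMap ℚ CK (counitHom (tree t))
  rw [antipodeHom_rTensor_comul, counitHom, liftTree_tree, ← graft_branches t,
    antipodeComulTree, RootedTree.fold_graft]
  simp

open WithConv in
theorem antipodeHom_right :
    toConv (AlgHom.id ℚ CK) * toConv antipodeHom = (1 : WithConv (CK →ₐ[ℚ] CK)) := by
  have h : toConv (antipodeHom.comp antipodeHom) * toConv antipodeHom =
      (1 : WithConv (CK →ₐ[ℚ] CK)) := by
    have h1 := AlgHom.comp_convMul_distrib antipodeHom (toConv antipodeHom)
      (toConv (AlgHom.id ℚ CK))
    rw [antipodeHom_left] at h1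
    refine WithConv.ext (Eq.trans h1.symm ?_)
    refine AlgHom.ext fun a => ?_
    change antipodeHom (algebraMap ℚ CK (counitHom a)) = algebraMap ℚ CK (counitHom a)
    exact antipodeHom.commutes _
  rw [left_inv_eq_right_inv h antipodeHom_left] at h
  exact h

open WithConv in
/-- The Connes–Kreimer Hopf algebra of rooted trees. -/
instance : HopfAlgebra ℚ CK :=
  HopfAlgebra.ofConvInverse antipodeHom.toLinearMap
    (congrArg (fun φ : WithConv (CK →ₐ[ℚ] CK) => toConv φ.ofConv.toLinearMap) antipodeHom_left)
    (congrArg (fun φ : WithConv (CK →ₐ[ℚ] CK) => toConv φ.ofConv.toLinearMap) antipodeHom_right)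

/-! ### Noncommutative polynomials -/

/-- The letters `x` and `y_s`, `s ∈ μ_r`. -/
inductive Letter (r : ℕ) : Type
  | x : Letter r
  | y (s : rootsOfUnity r ℂ) : Letter r

/-- The noncommutative polynomial algebra `𝒜_r = ℚ⟨x, y_s | s ∈ μ_r⟩`. -/
abbrev NCPoly (r : ℕ) : Type := FreeAlgebra ℚ (Letter r)

variable {r : ℕ}

/-- The generator `x`. -/
def X : NCPoly r := FreeAlgebra.ι ℚ Letter.x

/-- The generator `y_s`. -/
def Y (s : rootsOfUnity r ℂ) : NCPoly r := FreeAlgebra.ι ℚ (Letter.y s)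

/-- The element `z = x + y_1`. -/
def Z : NCPoly r := X + Y 1

open Classical in
/-- `δ(1) = 0` and `δ(s) = 1` for `s ≠ 1`. -/
def delta (s : rootsOfUnity r ℂ) : ℚ := if s = 1 then 0 else 1

/-- The element `z_s^δ = x + δ(s) y_s`. -/
def Zdelta (s : rootsOfUnity r ℂ) : NCPoly r := X + delta s • Y s

/-- A word (a list of letters, read from left to right) as a monomial. -/
def word (w : List (Letter r)) : NCPoly r := (w.map (FreeAlgebra.ι ℚ)).prod

/-- The linear map with prescribed values on words. -/
def liftWord {M : Type} [AddCommGroup M] [Module ℚ M] (g : List (Letter r) → M) :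
    NCPoly r →ₗ[ℚ] M :=
  (FreeAlgebra.basisFreeMonoid ℚ (Letter r)).constr ℚ fun w => g (FreeMonoid.toList w)

theorem liftWord_word {M : Type} [AddCommGroup M] [Module ℚ M] (g : List (Letter r) → M)
    (w : List (Letter r)) : liftWord g (word w) = g w := by
  have h : word w = FreeAlgebra.basisFreeMonoid ℚ (Letter r) (FreeMonoid.ofList w) := by
    rw [FreeAlgebra.basisFreeMonoid, Module.Basis.map_apply]
    simp [word, FreeAlgebra.equivMonoidAlgebraFreeMonoid]
  rw [h, liftWord, Module.Basis.constr_basis, FreeMonoid.toList_ofList]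

variable (r) in
/-- The subspace `𝒜_r^1 = ℚ ⊕ ⨁_s 𝒜_r y_s`. -/
def A1 : Submodule ℚ (NCPoly r) :=
  Submodule.span ℚ {1} ⊔ ⨆ s : rootsOfUnity r ℂ, LinearMap.range (LinearMap.mulRight ℚ (Y s))

/-- The inclusion `𝒜_1 ⊆ 𝒜_r`, with `x ↦ x` and `y_1 ↦ y_1`. -/
def incl : NCPoly 1 →ₐ[ℚ] NCPoly r :=
  FreeAlgebra.lift ℚ fun
    | .x => X
    | .y _ => Y 1

/-! ### The diamond product -/

/-- The automorphism `φ` of `𝒜_r` with `φ(x) = z` and `φ(y_s) = z_s^δ - z`. -/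
def phi : NCPoly r →ₐ[ℚ] NCPoly r :=
  FreeAlgebra.lift ℚ fun
    | .x => Z
    | .y s => Zdelta s - Z

/-- Multiply the index of the first `y` of a word by `s`. -/
def mulFirst (s : rootsOfUnity r ℂ) : List (Letter r) → List (Letter r)
  | [] => []
  | .x :: w => .x :: mulFirst s w
  | .y t :: w => .y (s * t) :: w

/-- Replace the indices `s₁, s₂, s₃, …` of the letters `y` of a word by
`p s₁, p s₁ s₂, p s₁ s₂ s₃, …`. -/
def partialProducts (p : rootsOfUnity r ℂ) : List (Letter r) → List (Letter r)
  | [] => []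
  | .x :: w => .x :: partialProducts p w
  | .y t :: w => .y (p * t) :: partialProducts (p * t) w

/-- The linear map `M_s`, with
`M_s (z_{k₁,s₁} z_{k₂,s₂} ⋯ z_{k_l,s_l} x^a) = z_{k₁,s s₁} z_{k₂,s₂} ⋯ z_{k_l,s_l} x^a`, where
`z_{k,s} = x^{k-1} y_s`. -/
def Mmap (s : rootsOfUnity r ℂ) : NCPoly r →ₗ[ℚ] NCPoly r :=
  liftWord fun w => word (mulFirst s w)

/-- The linear map `I`, with
`I (z_{k₁,s₁} z_{k₂,s₂} ⋯ z_{k_l,s_l} x^a) = z_{k₁,s₁} z_{k₂,s₁s₂} ⋯ z_{k_l,s₁⋯s_l} x^a`. -/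
def Imap : NCPoly r →ₗ[ℚ] NCPoly r :=
  liftWord fun w => word (partialProducts 1 w)

/-- The linear map `ψ_s = φ I M_s`. -/
def psi (s : rootsOfUnity r ℂ) : NCPoly r →ₗ[ℚ] NCPoly r :=
  phi.toLinearMap ∘ₗ Imap ∘ₗ Mmap s

open Classical in
/-- The diamond product of two words.  The arguments are the words read from right to left, so
that `a :: v` stands for the word `v a`. -/
def diamondWord (s : rootsOfUnity r ℂ) : List (Letter 1) → List (Letter r) → NCPoly r
  | [], w => word w.reverse
  | v, [] => psi s (incl (phi (word v.reverse)))
  | .x :: v, .x :: w =>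
      diamondWord s v (.x :: w) * X - diamondWord s (.y 1 :: v) w * X
  | .y _ :: v, .x :: w =>
      diamondWord s v (.x :: w) * Y 1 + diamondWord s (.y 1 :: v) w * X
  | .x :: v, .y t :: w =>
      if t = 1 then
        diamondWord s v (.y 1 :: w) * X + diamondWord s (.x :: v) w * Y 1
      else
        diamondWord s v (.y t :: w) * X
          + (diamondWord s v (.x :: w) + diamondWord s v (.y t :: w)) * Y t
          - diamondWord s (.y 1 :: v) w * Y t
  | .y _ :: v, .y t :: w =>
      if t = 1 then
        diamondWord s v (.y 1 :: w) * Y 1 - diamondWord s (.x :: v) w * Y 1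
      else
        diamondWord s v (.y t :: w) * Y 1
          - (diamondWord s v (.x :: w) + diamondWord s v (.y t :: w)) * Y t
          + diamondWord s (.y 1 :: v) w * Y t
termination_by v w => v.length + w.length

/-- The bilinear diamond product `v ◇_s w` of `v ∈ 𝒜_1` and `w ∈ 𝒜_r`. -/
def diamond (s : rootsOfUnity r ℂ) : NCPoly 1 →ₗ[ℚ] NCPoly r →ₗ[ℚ] NCPoly r :=
  liftWord fun v => liftWord fun w => diamondWord s v.reverse w.reverse

/-! ### Rooted tree maps -/

variable (r) in
/-- The letters `z` and `z_s^δ`, `s ∈ μ_r`. -/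
def zLetters : Set (NCPoly r) := insert Z (Set.range Zdelta)

/-- The defining conditions of the assignment `f ↦ f~` of the rooted tree maps. -/
structure IsRootedTreeMap (T : CK →ₗ[ℚ] Module.End ℚ (NCPoly r)) : Prop where
  /-- The empty forest acts as the identity. -/
  one : T 1 = 1
  /-- The one-vertex tree on `z_s^δ` and `z`. -/
  dot_Zdelta : ∀ s, T (tree (graft 0)) (Zdelta s) = Zdelta s * (Z - Zdelta s)
  dot_Z : T (tree (graft 0)) Z = 0
  /-- A tree `B₊ f`: if `R_w` is the right multiplication by `w`, then
  `(B₊ f)~ (z_s^δ) = R_{z - z_s^δ} R_{2z - z_s^δ} R_{z - z_s^δ}⁻¹ (f~ (z_s^δ))`, where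
  `u = R_{z - z_s^δ}⁻¹ (f~ (z_s^δ))` exists. -/
  graft_Zdelta : ∀ f : Multiset RootedTree, f ≠ 0 → ∀ s, ∃ u : NCPoly r,
    T (forest f) (Zdelta s) = u * (Z - Zdelta s) ∧
      T (Bplus (forest f)) (Zdelta s) = u * (2 * Z - Zdelta s) * (Z - Zdelta s)
  graft_Z : ∀ f : Multiset RootedTree, f ≠ 0 → T (Bplus (forest f)) Z = 0
  /-- A product of forests, on letters. -/
  mul : ∀ g h : Multiset RootedTree, ∀ v ∈ zLetters r,
    T (forest g * forest h) v = T (forest g) (T (forest h) v)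
  /-- A product `w v` with a letter `v`: if `Δ f = ∑ a ⊗ b`, then
  `f~ (w v) = ∑ a~ (w) b~ (v)`. -/
  comul : ∀ f : Multiset RootedTree, ∀ w : NCPoly r, ∀ v ∈ zLetters r,
    T (forest f) (w * v) = LinearMap.mul' ℚ (NCPoly r)
      (TensorProduct.map (T.flip w) (T.flip v) (Coalgebra.comul (R := ℚ) (forest f)))

end

end RootedTreeMaps

open RootedTreeMaps

namespace RootedTreeMaps

noncomputable section

variable {r : ℕ}

/-! ### Words and letters -/

theorem word_nil : word ([] : List (Letter r)) = 1 := rfl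

theorem word_reverse_x (w : List (Letter r)) :
    word (Letter.x :: w).reverse = word w.reverse * X := by
  simp [word, X]

theorem word_reverse_y (t : rootsOfUnity r ℂ) (w : List (Letter r)) :
    word (Letter.y t :: w).reverse = word w.reverse * Y t := by
  simp [word, Y]

/-- A linear property of noncommutative polynomials can be checked on words, read from right
to left. -/
theorem induction_words {p : NCPoly r → Prop}
    (word : ∀ w : List (Letter r), p (word w.reverse))
    (add : ∀ a b, p a → p b → p (a + b)) (smul : ∀ (c : ℚ) a, p a → p (c • a)) (a : NCPoly r) :
    p a := by
  have ha := (FreeAlgebra.basisFreeMonoid ℚ (Letter r)).mem_span a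
  refine Submodule.span_induction ?_ ?_ (fun a b _ _ => add a b) (fun c a _ => smul c a) ha
  · rintro _ ⟨w, rfl⟩
    have h := word (FreeMonoid.toList w).reverse
    rw [List.reverse_reverse] at h
    convert h
    rw [FreeAlgebra.basisFreeMonoid, Module.Basis.map_apply]
    simp [RootedTreeMaps.word, FreeAlgebra.equivMonoidAlgebraFreeMonoid, FreeMonoid.lift_apply]
  · have := smul 0 _ (word [])
    rwa [zero_smul] at this

/-- Induction on noncommutative polynomials, by right multiplication by letters. -/
theorem induction_right {p : NCPoly r → Prop} (one : p 1)
    (add : ∀ a b, p a → p b → p (a + b)) (smul : ∀ (c : ℚ) a, p a → p (c • a))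
    (mul_X : ∀ a, p a → p (a * X)) (mul_Y : ∀ t a, p a → p (a * Y t)) (a : NCPoly r) :
    p a := by
  refine induction_words (fun w => ?_) add smul a
  induction w with
  | nil => exact one
  | cons l w ih =>
    cases l with
    | x => rw [word_reverse_x]; exact mul_X _ ih
    | y t => rw [word_reverse_y]; exact mul_Y t _ ih

theorem Zdelta_one : Zdelta (1 : rootsOfUnity r ℂ) = X := by
  simp [Zdelta, delta]

theorem Zdelta_of_ne {t : rootsOfUnity r ℂ} (ht : t ≠ 1) : Zdelta t = X + Y t := by
  simp [Zdelta, delta, ht]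

/-- Induction on noncommutative polynomials, by right multiplication by `z` and `z_t^δ`. -/
theorem induction_zLetters {p : NCPoly r → Prop} (one : p 1)
    (add : ∀ a b, p a → p b → p (a + b)) (smul : ∀ (c : ℚ) a, p a → p (c • a))
    (mul_Z : ∀ a, p a → p (a * Z)) (mul_Zdelta : ∀ t a, p a → p (a * Zdelta t))
    (a : NCPoly r) : p a := by
  have hX : ∀ a, p a → p (a * X) := fun a ha => by
    rw [← Zdelta_one]; exact mul_Zdelta 1 a ha
  have hsub : ∀ a b, p a → p b → p (a - b) := fun a b ha hb => by
    have := add a _ ha (smul (-1) b hb)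
    rwa [neg_one_smul, ← sub_eq_add_neg] at this
  refine induction_right one add smul hX (fun t a ha => ?_) a
  by_cases ht : t = 1
  · have := hsub _ _ (mul_Z a ha) (hX a ha)
    rwa [← mul_sub, Z, add_sub_cancel_left, ← ht] at this
  · have := hsub _ _ (mul_Zdelta t a ha) (hX a ha)
    rwa [← mul_sub, Zdelta_of_ne ht, add_sub_cancel_left] at this

theorem root_eq_one (t : rootsOfUnity 1 ℂ) : t = 1 := by
  have h := t.2
  rw [mem_rootsOfUnity, pow_one] at h
  exact Subtype.ext h

/-- Induction on noncommutative polynomials in `x` and `y`, by right multiplication by `z`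
and `y`. -/
theorem induction_Z_Y {p : NCPoly 1 → Prop} (one : p 1)
    (add : ∀ a b, p a → p b → p (a + b)) (smul : ∀ (c : ℚ) a, p a → p (c • a))
    (mul_Z : ∀ a, p a → p (a * Z)) (mul_Y : ∀ a, p a → p (a * Y 1)) (a : NCPoly 1) : p a := by
  refine induction_right one add smul (fun a ha => ?_) (fun t a ha => ?_) a
  · have := add _ _ (mul_Z a ha) (smul (-1) _ (mul_Y a ha))
    rwa [neg_one_smul, ← sub_eq_add_neg, ← mul_sub, Z, add_sub_cancel_right] at this
  · rw [root_eq_one t]; exact mul_Y a ha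

/-! ### The homomorphisms `v ↦ v ◇_s 1` -/

/-- The homomorphism `𝒜_1 → 𝒜_r` with `x ↦ z_s^δ` and `z ↦ z`. -/
def theta (s : rootsOfUnity r ℂ) : NCPoly 1 →ₐ[ℚ] NCPoly r :=
  FreeAlgebra.lift ℚ fun
    | .x => Zdelta s
    | .y _ => Z - Zdelta s

theorem theta_X (s : rootsOfUnity r ℂ) : theta s X = Zdelta s := FreeAlgebra.lift_ι_apply _ _

theorem theta_Y (s : rootsOfUnity r ℂ) (t : rootsOfUnity 1 ℂ) :
    theta s (Y t) = Z - Zdelta s := FreeAlgebra.lift_ι_apply _ _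

theorem theta_Z (s : rootsOfUnity r ℂ) : theta s Z = Z := by
  rw [Z, map_add, theta_X, theta_Y, add_sub_cancel]

theorem incl_X : incl (r := r) X = X := FreeAlgebra.lift_ι_apply _ _

theorem incl_Y (t : rootsOfUnity 1 ℂ) : incl (r := r) (Y t) = Y 1 :=
  FreeAlgebra.lift_ι_apply _ _

theorem phi_X : phi (r := r) X = Z := FreeAlgebra.lift_ι_apply _ _

theorem phi_Y (t : rootsOfUnity r ℂ) : phi (Y t) = Zdelta t - Z :=
  FreeAlgebra.lift_ι_apply _ _

theorem ncpoly_algHom_ext {B : Type} [Ring B] [Algebra ℚ B] {f g : NCPoly r →ₐ[ℚ] B}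
    (hX : f X = g X) (hY : ∀ t, f (Y t) = g (Y t)) : f = g := by
  refine FreeAlgebra.hom_ext (funext fun l => ?_)
  cases l with
  | x => exact hX
  | y t => exact hY t

theorem theta_one_root : theta (1 : rootsOfUnity 1 ℂ) = AlgHom.id ℚ (NCPoly 1) := by
  refine ncpoly_algHom_ext ?_ fun t => ?_
  · simp [theta_X, Zdelta_one]
  · simp [theta_Y, Zdelta_one, Z, root_eq_one t]

theorem theta_one_root_eq_incl : theta (1 : rootsOfUnity r ℂ) = incl := by
  refine ncpoly_algHom_ext ?_ fun t => ?_
  · simp [theta_X, Zdelta_one, incl_X]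
  · simp [theta_Y, Zdelta_one, Z, incl_Y]

/-- The homomorphism `𝒜_1 → 𝒜_r` with `x ↦ x` and `y ↦ y_s`. -/
def inclAt (s : rootsOfUnity r ℂ) : NCPoly 1 →ₐ[ℚ] NCPoly r :=
  FreeAlgebra.lift ℚ fun
    | .x => X
    | .y _ => Y s

theorem inclAt_X (s : rootsOfUnity r ℂ) : inclAt s X = X := FreeAlgebra.lift_ι_apply _ _

theorem inclAt_Y (s : rootsOfUnity r ℂ) (t : rootsOfUnity 1 ℂ) : inclAt s (Y t) = Y s :=
  FreeAlgebra.lift_ι_apply _ _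

/-- The substitution `y ↦ y_s` on words. -/
def substWord (s : rootsOfUnity r ℂ) : List (Letter 1) → List (Letter r)
  | [] => []
  | .x :: w => .x :: substWord s w
  | .y _ :: w => .y s :: substWord s w

theorem word_cons_x (w : List (Letter r)) : word (Letter.x :: w) = X * word w := by
  simp [word, X]

theorem word_cons_y (t : rootsOfUnity r ℂ) (w : List (Letter r)) :
    word (Letter.y t :: w) = Y t * word w := by
  simp [word, Y]

theorem inclAt_word (s : rootsOfUnity r ℂ) (w : List (Letter 1)) :
    inclAt s (word w) = word (substWord s w) := by
  induction w with
  | nil => simp [word, substWord]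
  | cons l w ih =>
    cases l with
    | x => rw [substWord, word_cons_x, word_cons_x, map_mul, ih, inclAt_X]
    | y t => rw [substWord, word_cons_y, word_cons_y, map_mul, ih, inclAt_Y]

theorem incl_eq_inclAt : incl (r := r) = inclAt 1 :=
  ncpoly_algHom_ext (by rw [incl_X, inclAt_X]) fun t => by rw [incl_Y, inclAt_Y]

theorem partialProducts_substWord (s : rootsOfUnity r ℂ) (w : List (Letter 1)) :
    partialProducts s (substWord 1 w) = substWord s w := by
  induction w with
  | nil => rfl
  | cons l w ih =>
    cases l with
    | x => rw [substWord, partialProducts, substWord, ih]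
    | y t => rw [substWord, partialProducts, substWord, mul_one, ih]

theorem partialProducts_mulFirst (s : rootsOfUnity r ℂ) (w : List (Letter 1)) :
    partialProducts 1 (mulFirst s (substWord 1 w)) = substWord s w := by
  induction w with
  | nil => rfl
  | cons l w ih =>
    cases l with
    | x => rw [substWord, mulFirst, partialProducts, substWord, ih]
    | y t =>
      rw [substWord, mulFirst, partialProducts, substWord, mul_one, one_mul,
        partialProducts_substWord]

theorem Imap_Mmap_incl (s : rootsOfUnity r ℂ) (v : NCPoly 1) :
    Imap (Mmap s (incl v)) = inclAt s v := by
  induction v using induction_words with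
  | word w =>
    rw [incl_eq_inclAt, inclAt_word, inclAt_word, Mmap, liftWord_word, Imap, liftWord_word,
      partialProducts_mulFirst]
  | add a b ha hb => simp only [map_add, ha, hb]
  | smul c a ha => simp only [map_smul, ha]

theorem psi_incl_phi (s : rootsOfUnity r ℂ) (v : NCPoly 1) :
    psi s (incl (phi v)) = theta s v := by
  have h : phi.comp ((inclAt s).comp phi) = theta s := by
    refine ncpoly_algHom_ext ?_ fun t => ?_
    · simp [phi_X, Z, inclAt_X, inclAt_Y, phi_Y, theta_X]
    · simp [Z, inclAt_Y, phi_Y, theta_Y, root_eq_one t, Zdelta_one]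
  rw [← h]
  change phi (Imap (Mmap s (incl (phi v)))) = phi (inclAt s (phi v))
  rw [Imap_Mmap_incl]

/-! ### Rules of the diamond product -/

theorem diamond_word (s : rootsOfUnity r ℂ) (v : List (Letter 1)) (w : List (Letter r)) :
    diamond s (word v.reverse) (word w.reverse) = diamondWord s v w := by
  rw [diamond, liftWord_word, liftWord_word, List.reverse_reverse, List.reverse_reverse]

theorem one_diamond (s : rootsOfUnity r ℂ) (w : NCPoly r) : diamond s 1 w = w := by
  induction w using induction_words with
  | word w =>
    have := diamond_word s [] w
    rwa [diamondWord] at this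
  | add a b ha hb => rw [map_add, ha, hb]
  | smul c a ha => rw [map_smul, ha]

theorem diamond_one (s : rootsOfUnity r ℂ) (v : NCPoly 1) : diamond s v 1 = theta s v := by
  induction v using induction_words with
  | word v =>
    have := diamond_word s v []
    rw [List.reverse_nil, word_nil] at this
    rw [this]
    cases v with
    | nil => simp [diamondWord, word]
    | cons a v => rw [diamondWord, psi_incl_phi]; simp
  | add a b ha hb => rw [map_add, map_add, LinearMap.add_apply, ha, hb]
  | smul c a ha => rw [map_smul, map_smul, LinearMap.smul_apply, ha]

theorem mul_Z_diamond (s : rootsOfUnity r ℂ) (v : NCPoly 1) (w : NCPoly r) :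
    diamond s (v * Z) w = diamond s v w * Z := by
  induction v using induction_words with
  | word v =>
    induction w using induction_words with
    | word w =>
      cases w with
      | nil => simp only [List.reverse_nil, word_nil, diamond_one, map_mul, theta_Z]
      | cons l w =>
        simp only [Z, mul_add, map_add, LinearMap.add_apply, ← word_reverse_x,
          ← word_reverse_y, diamond_word]
        cases l with
        | x => simp only [diamondWord]; noncomm_ring
        | y t =>
          simp only [diamondWord]
          split_ifs with ht
          · rw [ht]; noncomm_ring
          · noncomm_ring
    | add a b ha hb => simp only [map_add, ha, hb, add_mul]
    | smul c a ha => simp only [map_smul, ha, smul_mul_assoc]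
  | add a b ha hb => simp only [map_add, LinearMap.add_apply, ha, hb, add_mul]
  | smul c a ha => simp only [map_smul, LinearMap.smul_apply, ha, smul_mul_assoc]

theorem mul_Y_diamond_mul_Zdelta (s t : rootsOfUnity r ℂ) (v : NCPoly 1) (w : NCPoly r) :
    diamond s (v * Y 1) (w * Zdelta t) =
      diamond s v (w * Zdelta t) * (Z - Zdelta t) + diamond s (v * Y 1) w * Zdelta t := by
  induction v using induction_words with
  | word v =>
    induction w using induction_words with
    | word w =>
      by_cases ht : t = 1
      · simp only [ht, Zdelta_one, ← word_reverse_x, ← word_reverse_y, diamond_word]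
        rw [diamondWord, Z, add_sub_cancel_left]
      · simp only [Zdelta_of_ne ht, mul_add, map_add, ← word_reverse_x, ← word_reverse_y,
          diamond_word, Z]
        rw [diamondWord, diamondWord, if_neg ht]
        noncomm_ring
    | add a b ha hb => simp only [map_add, ha, hb, add_mul]; abel
    | smul c a ha => simp only [map_smul, ha, smul_mul_assoc, smul_add]
  | add a b ha hb => simp only [map_add, LinearMap.add_apply, ha, hb, add_mul]; abel
  | smul c a ha => simp only [map_smul, LinearMap.smul_apply, ha, smul_mul_assoc, smul_add]

theorem diamond_mul_Z (s : rootsOfUnity r ℂ) (v : NCPoly 1) (w : NCPoly r) :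
    diamond s v (w * Z) = diamond s v w * Z := by
  induction v using induction_Z_Y generalizing w with
  | one => simp only [one_diamond]
  | add a b ha hb => simp only [map_add, LinearMap.add_apply, ha, hb, add_mul]
  | smul c a ha => simp only [map_smul, LinearMap.smul_apply, ha, smul_mul_assoc]
  | mul_Z a ha => rw [mul_Z_diamond, ha, mul_Z_diamond]
  | mul_Y a ha =>
    have key : ∀ (v : NCPoly 1) (w : NCPoly r), diamond s (v * Y 1) (w * Y 1) =
        diamond s v (w * Y 1) * Y 1 - diamond s (v * X) w * Y 1 := by
      intro v w
      induction v using induction_words with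
      | word v =>
        induction w using induction_words with
        | word w =>
          simp only [← word_reverse_x, ← word_reverse_y, diamond_word]
          rw [diamondWord, if_pos rfl]
        | add a b ha hb => simp only [map_add, ha, hb, add_mul]; abel
        | smul c a ha => simp only [map_smul, ha, smul_mul_assoc, smul_sub]
      | add a b ha hb => simp only [map_add, LinearMap.add_apply, ha, hb, add_mul]; abel
      | smul c a ha => simp only [map_smul, LinearMap.smul_apply, ha, smul_mul_assoc, smul_sub]
    have h1 := mul_Y_diamond_mul_Zdelta s 1 a w
    have h2 := mul_Z_diamond s a w
    rw [Zdelta_one] at h1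
    have h3 : diamond s (a * X) w = diamond s a w * Z - diamond s (a * Y 1) w := by
      rw [← h2, Z, mul_add, map_add, LinearMap.add_apply, add_sub_cancel_right]
    have h4 := ha w
    rw [Z, mul_add, map_add, ← eq_sub_iff_add_eq'] at h4
    rw [Z, mul_add, map_add, h1, key, h3, h4, Z]
    noncomm_ring

/-! ### Commutativity and associativity -/

theorem mul_Y_diamond_mul_Y (a b : NCPoly 1) :
    diamond 1 (a * Y 1) (b * Y 1) =
      (diamond 1 (a * Y 1) b + diamond 1 a (b * Y 1) - diamond 1 a b * Z) * Y 1 := by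
  have h1 := mul_Y_diamond_mul_Zdelta 1 1 a b
  have h2 := diamond_mul_Z 1 (a * Y 1) b
  have h3 := diamond_mul_Z 1 a b
  rw [Z, mul_add, map_add, ← eq_sub_iff_add_eq'] at h2
  rw [Z, mul_add, map_add, ← eq_sub_iff_add_eq] at h3
  rw [Zdelta_one, h3] at h1
  rw [h2, h1, Z]
  noncomm_ring

theorem diamond_comm (a b : NCPoly 1) : diamond 1 a b = diamond 1 b a := by
  induction a using induction_Z_Y generalizing b with
  | one => rw [one_diamond, diamond_one, theta_one_root, AlgHom.id_apply]
  | add a a' h h' => rw [map_add, map_add, LinearMap.add_apply, h, h']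
  | smul c a h => rw [map_smul, map_smul, LinearMap.smul_apply, h]
  | mul_Z a h => rw [mul_Z_diamond, diamond_mul_Z, h]
  | mul_Y a h =>
    induction b using induction_Z_Y with
    | one => rw [one_diamond, diamond_one, theta_one_root, AlgHom.id_apply]
    | add b b' h h' => rw [map_add, map_add, LinearMap.add_apply, h, h']
    | smul c b h => rw [map_smul, map_smul, LinearMap.smul_apply, h]
    | mul_Z b h' => rw [mul_Z_diamond, diamond_mul_Z, h']
    | mul_Y b h' =>
      rw [mul_Y_diamond_mul_Y, mul_Y_diamond_mul_Y, h', h, h]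
      congr 2
      abel

theorem diamond_theta (s : rootsOfUnity r ℂ) (a b : NCPoly 1) :
    diamond s a (theta s b) = theta s (diamond 1 a b) := by
  induction b using induction_zLetters generalizing a with
  | one => rw [map_one, diamond_one, diamond_one, theta_one_root, AlgHom.id_apply]
  | add b b' h h' => simp only [map_add, h, h']
  | smul c b h => simp only [map_smul, h]
  | mul_Z b h => rw [map_mul, theta_Z, diamond_mul_Z, diamond_mul_Z, map_mul, theta_Z, h]
  | mul_Zdelta t b h =>
    rw [root_eq_one t]
    induction a using induction_Z_Y with
    | one => rw [one_diamond, one_diamond]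
    | add a a' h h' => simp only [map_add, LinearMap.add_apply, h, h']
    | smul c a h => simp only [map_smul, LinearMap.smul_apply, h]
    | mul_Z a h => rw [mul_Z_diamond, mul_Z_diamond, h, map_mul (theta s), theta_Z]
    | mul_Y a h' =>
      have hx : theta s (Zdelta 1) = Zdelta s := by rw [Zdelta_one, theta_X]
      rw [map_mul (theta s), hx] at h' ⊢
      rw [mul_Y_diamond_mul_Zdelta, mul_Y_diamond_mul_Zdelta, map_add, map_mul (theta s),
        map_mul (theta s), map_sub, theta_Z, hx, ← h', ← h]

/-- `𝒜_r` with `◇_s` is a module over `𝒜_1` with `◇_1`. -/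
theorem diamond_assoc (s : rootsOfUnity r ℂ) (a b : NCPoly 1) (w : NCPoly r) :
    diamond s (diamond 1 a b) w = diamond s a (diamond s b w) := by
  induction w using induction_zLetters generalizing a b with
  | one => rw [diamond_one, diamond_one, diamond_theta]
  | add w w' h h' => simp only [map_add, h, h']
  | smul c w h => simp only [map_smul, h]
  | mul_Z w h => simp only [diamond_mul_Z, h]
  | mul_Zdelta t w hw =>
    induction a using induction_Z_Y generalizing b with
    | one => rw [one_diamond, one_diamond]
    | add a a' h h' => simp only [map_add, LinearMap.add_apply, h, h']
    | smul c a h => simp only [map_smul, LinearMap.smul_apply, h]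
    | mul_Z a h => rw [mul_Z_diamond, mul_Z_diamond, mul_Z_diamond, h]
    | mul_Y a ha =>
      induction b using induction_Z_Y with
      | one => rw [one_diamond, diamond_one, theta_one_root, AlgHom.id_apply]
      | add b b' h h' => simp only [map_add, LinearMap.add_apply, h, h']
      | smul c b h => simp only [map_smul, LinearMap.smul_apply, h]
      | mul_Z b h => rw [diamond_mul_Z, mul_Z_diamond, mul_Z_diamond, diamond_mul_Z, h]
      | mul_Y b hb =>
        have hY := hw (a * Y 1) (b * Y 1)
        rw [mul_Y_diamond_mul_Y] at hY
        rw [mul_Y_diamond_mul_Y, mul_Y_diamond_mul_Zdelta, hY,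
          mul_Y_diamond_mul_Zdelta s t b w, map_add, mul_sub (diamond s b (w * Zdelta t)),
          map_sub (diamond s (a * Y 1)), diamond_mul_Z s (a * Y 1), ← hb]
        have h1 := mul_Y_diamond_mul_Zdelta s t a (diamond s b (w * Zdelta t))
        have h2 := mul_Y_diamond_mul_Zdelta s t a (diamond s (b * Y 1) w)
        have h3 : diamond s a (diamond s b (w * Zdelta t) * Zdelta t) =
            diamond s (diamond 1 a b) (w * Zdelta t) * Z -
              diamond s (diamond 1 a (b * Y 1)) (w * Zdelta t) +
              diamond s a (diamond s (b * Y 1) w * Zdelta t) := by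
          rw [ha, ha, mul_Y_diamond_mul_Zdelta s t b w, mul_sub, map_add, map_sub,
            diamond_mul_Z]
          abel
        rw [h1, h2, h3, ← hb]
        simp only [map_sub, map_add, LinearMap.sub_apply, LinearMap.add_apply, mul_Z_diamond]
        noncomm_ring

/-! ### The commutative algebra `(𝒜_1, ◇)` -/

/-- The vector space `𝒜_1`, with the product `◇`. -/
def DiamondAlg : Type := NCPoly 1

namespace DiamondAlg

instance : AddCommGroup DiamondAlg := inferInstanceAs (AddCommGroup (NCPoly 1))

instance : Module ℚ DiamondAlg := inferInstanceAs (Module ℚ (NCPoly 1))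

/-- The identification of vector spaces. -/
def of : NCPoly 1 ≃ₗ[ℚ] DiamondAlg := LinearEquiv.refl ℚ (NCPoly 1)

instance : CommRing DiamondAlg where
  __ := (inferInstance : AddCommGroup DiamondAlg)
  mul a b := of (diamond 1 (of.symm a) (of.symm b))
  one := of 1
  mul_assoc a b c := congrArg of (diamond_assoc 1 (of.symm a) (of.symm b) (of.symm c))
  mul_comm a b := congrArg of (diamond_comm (of.symm a) (of.symm b))
  one_mul a := congrArg of (one_diamond 1 (of.symm a))
  mul_one a := congrArg of (by rw [diamond_one, theta_one_root]; rfl : diamond 1 (of.symm a) 1 = _)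
  left_distrib a b c := congrArg of (map_add (diamond 1 (of.symm a)) (of.symm b) (of.symm c))
  right_distrib a b c :=
    congrArg of (LinearMap.map_add₂ (diamond 1) (of.symm a) (of.symm b) (of.symm c))
  zero_mul a := congrArg of (LinearMap.map_zero₂ (diamond 1) (of.symm a))
  mul_zero a := congrArg of (map_zero (diamond 1 (of.symm a)))

theorem of_one : of 1 = 1 := rfl

instance : Algebra ℚ DiamondAlg :=
  Algebra.ofModule
    (fun c a b => congrArg of (LinearMap.map_smul₂ (diamond 1) c (of.symm a) (of.symm b)))
    (fun c a b => congrArg of (map_smul (diamond 1 (of.symm a)) c (of.symm b)))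

theorem induction {p : DiamondAlg → Prop} (h : ∀ a, p (of a)) (a : DiamondAlg) : p a := h a

/-- Right concatenation with a polynomial. -/
def concat (c : NCPoly 1) : DiamondAlg →ₗ[ℚ] DiamondAlg :=
  of.toLinearMap ∘ₗ LinearMap.mulRight ℚ c ∘ₗ of.symm.toLinearMap

theorem concat_of (c a : NCPoly 1) : concat c (of a) = of (a * c) := rfl

theorem concat_mul (c d : NCPoly 1) (a : DiamondAlg) :
    concat (c * d) a = concat d (concat c a) :=
  congrArg of (mul_assoc (of.symm a) c d).symm

theorem concat_add (c d : NCPoly 1) (a : DiamondAlg) :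
    concat (c + d) a = concat c a + concat d a :=
  congrArg of (mul_add (of.symm a) c d)

theorem concat_Z_mul (a b : DiamondAlg) : concat Z a * b = concat Z (a * b) :=
  congrArg of (mul_Z_diamond 1 (of.symm a) (of.symm b))

theorem mul_concat_Z (a b : DiamondAlg) : a * concat Z b = concat Z (a * b) :=
  congrArg of (diamond_mul_Z 1 (of.symm a) (of.symm b))

theorem concat_Y_mul_concat_Y (a b : DiamondAlg) :
    concat (Y 1) a * concat (Y 1) b =
      concat (Y 1) (concat (Y 1) a * b + a * concat (Y 1) b - concat Z (a * b)) :=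
  congrArg of (mul_Y_diamond_mul_Y (of.symm a) (of.symm b))

/-- Induction on elements, by right concatenation with `z` and `y`. -/
theorem induction_concat {p : DiamondAlg → Prop} (one : p 1)
    (add : ∀ a b, p a → p b → p (a + b)) (smul : ∀ (c : ℚ) a, p a → p (c • a))
    (concat_Z : ∀ a, p a → p (concat Z a)) (concat_Y : ∀ a, p a → p (concat (Y 1) a))
    (a : DiamondAlg) : p a :=
  induction_Z_Y (p := p) one add smul concat_Z concat_Y a

/-! ### Deconcatenation -/

/-- Deconcatenation on words, which are read from right to left. -/
def deconcatWord : List (Letter 1) → DiamondAlg ⊗[ℚ] DiamondAlg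
  | [] => 1
  | .x :: w => (concat X).lTensor DiamondAlg (deconcatWord w) -
      of (word w.reverse * Y 1) ⊗ₜ 1
  | .y _ :: w => (concat (Y 1)).lTensor DiamondAlg (deconcatWord w) +
      of (word w.reverse * Y 1) ⊗ₜ 1

/-- Deconcatenation: it sends a word `v` in the letters `z` and `y` to the sum of `p ⊗ q` over
all factorizations `v = p q` in which `p` is empty or ends in `y`. -/
def deconcat : DiamondAlg →ₗ[ℚ] DiamondAlg ⊗[ℚ] DiamondAlg :=
  liftWord (fun w => deconcatWord w.reverse) ∘ₗ of.symm.toLinearMap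

theorem deconcat_word (w : List (Letter 1)) :
    deconcat (of (word w.reverse)) = deconcatWord w := by
  rw [deconcat, LinearMap.comp_apply]
  refine (liftWord_word _ _).trans ?_
  rw [List.reverse_reverse]

theorem deconcat_one : deconcat 1 = 1 := deconcat_word []

theorem deconcat_concat_X (a : DiamondAlg) :
    deconcat (concat X a) = (concat X).lTensor DiamondAlg (deconcat a) -
      concat (Y 1) a ⊗ₜ 1 := by
  induction a using induction with | h a => ?_
  induction a using induction_words with
  | word w =>
    rw [concat_of, concat_of, ← word_reverse_x, deconcat_word, deconcat_word, deconcatWord]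
  | add a b ha hb => simp only [map_add, ha, hb, TensorProduct.add_tmul]; abel
  | smul c a ha => simp only [map_smul, ha, smul_sub, TensorProduct.smul_tmul']

theorem deconcat_concat_Y (a : DiamondAlg) :
    deconcat (concat (Y 1) a) = (concat (Y 1)).lTensor DiamondAlg (deconcat a) +
      concat (Y 1) a ⊗ₜ 1 := by
  induction a using induction with | h a => ?_
  induction a using induction_words with
  | word w =>
    rw [concat_of, ← word_reverse_y, deconcat_word, deconcat_word, deconcatWord,
      word_reverse_y]
  | add a b ha hb => simp only [map_add, ha, hb, TensorProduct.add_tmul]; abel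
  | smul c a ha => simp only [map_smul, ha, smul_add, TensorProduct.smul_tmul']

theorem lTensor_concat_add (c d : NCPoly 1) (t : DiamondAlg ⊗[ℚ] DiamondAlg) :
    (concat (c + d)).lTensor DiamondAlg t =
      (concat c).lTensor DiamondAlg t + (concat d).lTensor DiamondAlg t := by
  rw [← LinearMap.add_apply, ← LinearMap.lTensor_add]
  congr 2
  exact LinearMap.ext fun a => concat_add c d a

theorem lTensor_concat_mul (c d : NCPoly 1) (t : DiamondAlg ⊗[ℚ] DiamondAlg) :
    (concat (c * d)).lTensor DiamondAlg t =
      (concat d).lTensor DiamondAlg ((concat c).lTensor DiamondAlg t) := by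
  rw [← LinearMap.lTensor_comp_apply]
  congr 2
  exact LinearMap.ext fun a => concat_mul c d a

theorem deconcat_concat_Z (a : DiamondAlg) :
    deconcat (concat Z a) = (concat Z).lTensor DiamondAlg (deconcat a) := by
  rw [Z, concat_add, map_add, deconcat_concat_X, deconcat_concat_Y, lTensor_concat_add]
  abel

theorem lTensor_concat_Z_mul (s t : DiamondAlg ⊗[ℚ] DiamondAlg) :
    (concat Z).lTensor DiamondAlg s * t = (concat Z).lTensor DiamondAlg (s * t) := by
  induction s with
  | zero => simp
  | add s s' h h' => simp only [map_add, add_mul, h, h']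
  | tmul a b =>
    induction t with
    | zero => simp
    | add t t' h h' => simp only [map_add, mul_add, h, h']
    | tmul c d => simp [concat_Z_mul]

theorem lTensor_concat_Y_mul_lTensor_concat_Y (s t : DiamondAlg ⊗[ℚ] DiamondAlg) :
    (concat (Y 1)).lTensor DiamondAlg s * (concat (Y 1)).lTensor DiamondAlg t =
      (concat (Y 1)).lTensor DiamondAlg
        ((concat (Y 1)).lTensor DiamondAlg s * t + s * (concat (Y 1)).lTensor DiamondAlg t -
          (concat Z).lTensor DiamondAlg (s * t)) := by
  induction s with
  | zero => simp
  | add s s' h h' => simp only [map_add, map_sub, add_mul, h, h']; abel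
  | tmul a b =>
    induction t with
    | zero => simp
    | add t t' h h' => simp only [map_add, map_sub, mul_add, h, h']; abel
    | tmul c d =>
      simp only [LinearMap.lTensor_tmul, Algebra.TensorProduct.tmul_mul_tmul,
        concat_Y_mul_concat_Y, TensorProduct.tmul_add, TensorProduct.tmul_sub, map_add, map_sub]

theorem lTensor_concat_mul_tmul_one (c : NCPoly 1) (s : DiamondAlg ⊗[ℚ] DiamondAlg)
    (a : DiamondAlg) :
    (concat c).lTensor DiamondAlg s * a ⊗ₜ 1 = (concat c).lTensor DiamondAlg (s * a ⊗ₜ 1) := by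
  induction s with
  | zero => simp
  | add s s' h h' => simp only [map_add, add_mul, h, h']
  | tmul b d => simp

theorem deconcat_mul (a b : DiamondAlg) : deconcat (a * b) = deconcat a * deconcat b := by
  induction a using induction_concat generalizing b with
  | one => rw [one_mul, deconcat_one, one_mul]
  | add a a' h h' => simp only [add_mul, map_add, h, h']
  | smul c a h => simp only [smul_mul_assoc, map_smul, h]
  | concat_Z a h =>
    rw [concat_Z_mul, deconcat_concat_Z, deconcat_concat_Z, h, lTensor_concat_Z_mul]
  | concat_Y a ha =>
    induction b using induction_concat with
    | one => rw [mul_one, deconcat_one, mul_one]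
    | add b b' h h' => simp only [mul_add, map_add, h, h']
    | smul c b h => simp only [mul_smul_comm, map_smul, h]
    | concat_Z b h =>
      rw [mul_concat_Z, deconcat_concat_Z, deconcat_concat_Z, h,
        mul_comm _ ((concat Z).lTensor DiamondAlg (deconcat b)), lTensor_concat_Z_mul,
        mul_comm (deconcat b)]
    | concat_Y b hb =>
      have h : (concat (Y 1) a ⊗ₜ[ℚ] (1 : DiamondAlg)) * (concat (Y 1) b ⊗ₜ[ℚ] (1 : DiamondAlg)) =
          concat (Y 1) (concat (Y 1) a * b + a * concat (Y 1) b - concat Z (a * b)) ⊗ₜ 1 := by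
        rw [Algebra.TensorProduct.tmul_mul_tmul, concat_Y_mul_concat_Y, mul_one]
      rw [concat_Y_mul_concat_Y, deconcat_concat_Y, deconcat_concat_Y, deconcat_concat_Y,
        add_mul, mul_add, mul_add, h, lTensor_concat_Y_mul_lTensor_concat_Y, map_sub, map_add,
        hb, ha, deconcat_concat_Z, ha, deconcat_concat_Y, deconcat_concat_Y,
        lTensor_concat_mul_tmul_one, mul_comm (concat (Y 1) a ⊗ₜ[ℚ] (1 : DiamondAlg)),
        lTensor_concat_mul_tmul_one, add_mul, mul_add,
        mul_comm (deconcat b) (concat (Y 1) a ⊗ₜ[ℚ] (1 : DiamondAlg))]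
      simp only [map_add, map_sub]
      abel

/-- Deconcatenation as a homomorphism of algebras. -/
def deconcatHom : DiamondAlg →ₐ[ℚ] DiamondAlg ⊗[ℚ] DiamondAlg :=
  AlgHom.ofLinearMap deconcat deconcat_one deconcat_mul

/-- The product `v ◇_s (w z_t^δ)` in terms of the deconcatenation of `v`. -/
theorem diamond_mul_Zdelta (s t : rootsOfUnity r ℂ) (v : DiamondAlg) (w : NCPoly r) :
    diamond s (of.symm v) (w * Zdelta t) =
      LinearMap.mul' ℚ (NCPoly r) (TensorProduct.map
        (LinearMap.mulRight ℚ (Zdelta t) ∘ₗ (diamond s).flip w ∘ₗ of.symm.toLinearMap)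
        ((theta t).toLinearMap ∘ₗ of.symm.toLinearMap) (deconcat v)) := by
  set F := LinearMap.mul' ℚ (NCPoly r) ∘ₗ (TensorProduct.map
        (LinearMap.mulRight ℚ (Zdelta t) ∘ₗ (diamond s).flip w ∘ₗ of.symm.toLinearMap)
        ((theta t).toLinearMap ∘ₗ of.symm.toLinearMap)) with hF
  have hmul : ∀ c z, F ((concat c).lTensor DiamondAlg z) = F z * theta t c := by
    intro c z
    induction z with
    | zero => simp
    | add z z' h h' => simp only [map_add, add_mul, h, h']
    | tmul a b =>
      simp only [hF, LinearMap.comp_apply, LinearMap.lTensor_tmul, TensorProduct.map_tmul,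
        LinearMap.mul'_apply, mul_assoc]
      congr 2
      exact map_mul (theta t) (of.symm b) c
  have hone : ∀ a : DiamondAlg, F (a ⊗ₜ 1) = diamond s (of.symm a) w * Zdelta t := by
    intro a
    have : theta t (of.symm 1) = 1 := map_one (theta t)
    simp [hF, this]
  change _ = F (deconcat v)
  induction v using induction_concat with
  | one =>
    rw [deconcat_one, Algebra.TensorProduct.one_def, hone]
    have h : of.symm 1 = 1 := rfl
    rw [h, one_diamond, one_diamond]
  | add a a' h h' => simp only [map_add, LinearMap.add_apply, h, h']
  | smul c a h => simp only [map_smul, LinearMap.smul_apply, h]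
  | concat_Z a h =>
    rw [deconcat_concat_Z, hmul, ← h, theta_Z]
    exact mul_Z_diamond s _ _
  | concat_Y a h =>
    rw [deconcat_concat_Y, map_add, hmul, hone, ← h, theta_Y]
    exact mul_Y_diamond_mul_Zdelta s t _ _

/-! ### The operator that corresponds to grafting -/

/-- The operator `graftOp` on words, which are read from right to left. -/
def graftOpWord : List (Letter 1) → DiamondAlg
  | [] => of (Y 1)
  | .x :: w => -of (word w.reverse * ((Z + Y 1) * Y 1))
  | .y _ :: w => of (word w.reverse * ((Z + Y 1) * Y 1))

/-- The linear operator with `1 ↦ y`, `v y ↦ v (z + y) y` and `v z ↦ 0`. -/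
def graftOp : DiamondAlg →ₗ[ℚ] DiamondAlg :=
  liftWord (fun w => graftOpWord w.reverse) ∘ₗ of.symm.toLinearMap

theorem graftOp_word (w : List (Letter 1)) :
    graftOp (of (word w.reverse)) = graftOpWord w := by
  rw [graftOp, LinearMap.comp_apply]
  refine (liftWord_word _ _).trans ?_
  rw [List.reverse_reverse]

theorem graftOp_one : graftOp 1 = of (Y 1) := graftOp_word []

theorem graftOp_concat_Y (a : DiamondAlg) :
    graftOp (concat (Y 1) a) = concat ((Z + Y 1) * Y 1) a := by
  induction a using induction with | h a => ?_
  induction a using induction_words with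
  | word w => rw [concat_of, concat_of, ← word_reverse_y, graftOp_word, graftOpWord]
  | add a b ha hb => simp only [map_add, ha, hb]
  | smul c a ha => simp only [map_smul, ha]

theorem graftOp_concat_X (a : DiamondAlg) :
    graftOp (concat X a) = -concat ((Z + Y 1) * Y 1) a := by
  induction a using induction with | h a => ?_
  induction a using induction_words with
  | word w => rw [concat_of, concat_of, ← word_reverse_x, graftOp_word, graftOpWord]
  | add a b ha hb => simp only [map_add, ha, hb]; abel
  | smul c a ha => simp only [map_smul, ha, smul_neg]

theorem graftOp_concat_Z (a : DiamondAlg) : graftOp (concat Z a) = 0 := by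
  rw [Z, concat_add, map_add, graftOp_concat_X, graftOp_concat_Y, neg_add_cancel]

theorem of_Y : of (Y 1) = concat (Y 1) 1 := by
  rw [← of_one, concat_of, one_mul]

/-- The operator `graftOp` is a cocycle for deconcatenation. -/
theorem deconcat_graftOp (a : DiamondAlg) :
    deconcat (graftOp a) = graftOp a ⊗ₜ 1 + graftOp.lTensor DiamondAlg (deconcat a) := by
  have hY : ∀ t : DiamondAlg ⊗[ℚ] DiamondAlg,
      graftOp.lTensor DiamondAlg ((concat (Y 1)).lTensor DiamondAlg t) =
        (concat ((Z + Y 1) * Y 1)).lTensor DiamondAlg t := by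
    intro t
    rw [← LinearMap.lTensor_comp_apply]
    congr 2
    exact LinearMap.ext graftOp_concat_Y
  have hZ : ∀ t : DiamondAlg ⊗[ℚ] DiamondAlg,
      graftOp.lTensor DiamondAlg ((concat Z).lTensor DiamondAlg t) = 0 := by
    intro t
    rw [← LinearMap.lTensor_comp_apply]
    have : graftOp ∘ₗ concat Z = 0 := LinearMap.ext graftOp_concat_Z
    rw [this, LinearMap.lTensor_zero, LinearMap.zero_apply]
  induction a using induction_concat with
  | one =>
    rw [graftOp_one, of_Y, deconcat_concat_Y, deconcat_one, Algebra.TensorProduct.one_def,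
      LinearMap.lTensor_tmul, LinearMap.lTensor_tmul, graftOp_one, of_Y]
    abel
  | add a b ha hb => simp only [map_add, ha, hb, TensorProduct.add_tmul]; abel
  | smul c a ha => simp only [map_smul, ha, smul_add, TensorProduct.smul_tmul']
  | concat_Z a ha =>
    rw [graftOp_concat_Z, deconcat_concat_Z, hZ, map_zero, TensorProduct.zero_tmul, add_zero]
  | concat_Y a ha =>
    rw [graftOp_concat_Y, deconcat_concat_Y, map_add, hY, concat_mul, deconcat_concat_Y,
      concat_add, map_add, deconcat_concat_Z, deconcat_concat_Y, LinearMap.lTensor_tmul,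
      graftOp_one, lTensor_concat_mul, lTensor_concat_add]
    simp only [map_add, LinearMap.lTensor_tmul, ← of_Y, TensorProduct.add_tmul]
    abel

end DiamondAlg

/-! ### The Connes–Kreimer Hopf algebra -/

theorem forest_zero : forest 0 = 1 := rfl

theorem forest_cons (t : RootedTree) (f : Multiset RootedTree) :
    forest (t ::ₘ f) = tree t * forest f := by
  simp [forest]

theorem induction_forest {p : CK → Prop} (forest : ∀ f, p (forest f))
    (add : ∀ a b, p a → p b → p (a + b)) (smul : ∀ (c : ℚ) a, p a → p (c • a)) (a : CK) :
    p a := by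
  refine Submodule.span_induction ?_ ?_ (fun a b _ _ => add a b) (fun c a _ => smul c a)
    (forestBasis.mem_span a)
  · rintro _ ⟨f, rfl⟩
    rw [forestBasis_apply]
    exact forest f
  · have := smul 0 _ (forest 0)
    rwa [zero_smul] at this

theorem counitHom_tree (t : RootedTree) : counitHom (tree t) = 0 := liftTree_tree _ _

theorem counitHom_forest {f : Multiset RootedTree} (hf : f ≠ 0) : counitHom (forest f) = 0 := by
  obtain ⟨t, ht⟩ := Multiset.exists_mem_of_ne_zero hf
  obtain ⟨g, rfl⟩ := Multiset.exists_cons_of_mem ht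
  rw [forest_cons, map_mul, counitHom_tree, zero_mul]

/-- The convolution with a multiple of the counit. -/
theorem mul'_map_counit (F : CK →ₗ[ℚ] NCPoly r) (v : NCPoly r) (a : CK) :
    LinearMap.mul' ℚ (NCPoly r) (TensorProduct.map F
      (LinearMap.toSpanSingleton ℚ (NCPoly r) v ∘ₗ counitHom.toLinearMap) (comulHom a)) =
      F a * v := by
  have h := Coalgebra.lTensor_counit_comul (R := ℚ) a
  have h2 : TensorProduct.map F
      (LinearMap.toSpanSingleton ℚ (NCPoly r) v ∘ₗ counitHom.toLinearMap) (comulHom a) =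
      TensorProduct.map F (LinearMap.toSpanSingleton ℚ (NCPoly r) v)
        ((Coalgebra.counit (R := ℚ) (A := CK)).lTensor CK (Coalgebra.comul (R := ℚ) a)) := by
    rw [LinearMap.lTensor, ← LinearMap.comp_apply, ← TensorProduct.map_comp]
    rfl
  rw [h2, h]
  simp

/-! ### The homomorphism from rooted forests to `(𝒜_1, ◇)` -/

open DiamondAlg

/-- The homomorphism from the Connes–Kreimer Hopf algebra to `(𝒜_1, ◇)` that intertwines the
grafting operator with `graftOp`. -/
def toDiamond : CK →ₐ[ℚ] DiamondAlg := liftTree (RootedTree.fold fun m => graftOp m.prod)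

theorem toDiamond_tree_graft (f : Multiset RootedTree) :
    toDiamond (tree (graft f)) = graftOp (toDiamond (forest f)) := by
  rw [map_forest]
  simp only [toDiamond, liftTree_tree, RootedTree.fold_graft]

theorem toDiamond_Bplus (a : CK) : toDiamond (Bplus a) = graftOp (toDiamond a) := by
  induction a using induction_forest with
  | forest f => rw [Bplus_forest, toDiamond_tree_graft]
  | add a b ha hb => simp only [map_add, ha, hb]
  | smul c a ha => simp only [map_smul, ha]

theorem deconcat_toDiamond (a : CK) :
    deconcat (toDiamond a) =
      TensorProduct.map toDiamond.toLinearMap toDiamond.toLinearMap (comulHom a) := by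
  have h : deconcatHom.comp toDiamond =
      (Algebra.TensorProduct.map toDiamond toDiamond).comp comulHom := by
    refine algHom_ext fun t => ?_
    induction t using RootedTree.induction with
    | h f ih =>
      have hf := forest_congr ih
      simp only [AlgHom.comp_apply] at hf ⊢
      have h1 : ∀ z : CK ⊗[ℚ] CK,
          Algebra.TensorProduct.map toDiamond toDiamond (Bplus.lTensor CK z) =
          graftOp.lTensor DiamondAlg (Algebra.TensorProduct.map toDiamond toDiamond z) := by
        intro z
        induction z with
        | zero => simp
        | add x y hx hy => simp only [map_add, hx, hy]
        | tmul a b => simp [toDiamond_Bplus]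
      rw [comulHom_tree_graft, map_add, h1, ← hf, toDiamond_tree_graft]
      refine (deconcat_graftOp _).trans ?_
      rw [Algebra.TensorProduct.map_tmul, toDiamond_tree_graft, map_one]
      rfl
  exact DFunLike.congr_fun h a

theorem graftOp_mem_range (a : DiamondAlg) : graftOp a ∈ LinearMap.range (concat (Y 1)) := by
  induction a using induction_concat with
  | one => exact ⟨1, by rw [graftOp_one, of_Y]⟩
  | add a b ha hb => rw [map_add]; exact add_mem ha hb
  | smul c a ha => rw [map_smul]; exact Submodule.smul_mem _ _ ha
  | concat_Z a ha => rw [graftOp_concat_Z]; exact zero_mem _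
  | concat_Y a ha => exact ⟨concat (Z + Y 1) a, by rw [graftOp_concat_Y, concat_mul]⟩

theorem mul_mem_range_concat_Y {a b : DiamondAlg} (ha : a ∈ LinearMap.range (concat (Y 1)))
    (hb : b ∈ LinearMap.range (concat (Y 1))) : a * b ∈ LinearMap.range (concat (Y 1)) := by
  obtain ⟨a, rfl⟩ := ha
  obtain ⟨b, rfl⟩ := hb
  exact ⟨_, (concat_Y_mul_concat_Y a b).symm⟩

theorem toDiamond_sub_counit_mem (a : CK) :
    toDiamond a - counitHom a • 1 ∈ LinearMap.range (concat (Y 1)) := by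
  induction a using induction_forest with
  | forest f =>
    induction f using Multiset.induction_on with
    | empty => rw [forest_zero, map_one, map_one, one_smul, sub_self]; exact zero_mem _
    | cons t f ih =>
      have ht : toDiamond (tree t) ∈ LinearMap.range (concat (Y 1)) := by
        rw [← graft_branches t, toDiamond_tree_graft]
        exact graftOp_mem_range _
      rw [forest_cons, map_mul, map_mul, counitHom_tree, zero_mul, zero_smul, sub_zero]
      have h : toDiamond (tree t) * toDiamond (forest f) =
          toDiamond (tree t) * (toDiamond (forest f) - counitHom (forest f) • 1) +
            counitHom (forest f) • toDiamond (tree t) := by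
        rw [mul_sub, mul_smul_comm, mul_one, sub_add_cancel]
      rw [h]
      exact add_mem (mul_mem_range_concat_Y ht ih) (Submodule.smul_mem _ _ ht)
  | add a b ha hb =>
    rw [map_add, map_add, add_smul, add_sub_add_comm]
    exact add_mem ha hb
  | smul c a ha =>
    rw [map_smul, map_smul, smul_assoc, ← smul_sub]
    exact Submodule.smul_mem _ _ ha

theorem toDiamond_mem_A1 (a : CK) : of.symm (toDiamond a) ∈ A1 1 := by
  obtain ⟨k, hk⟩ := toDiamond_sub_counit_mem a
  have h : of.symm (toDiamond a) = counitHom a • (1 : NCPoly 1) + of.symm k * Y 1 := by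
    rw [← sub_eq_iff_eq_add']
    exact hk.symm
  rw [h]
  refine add_mem (Submodule.mem_sup_left ?_) (Submodule.mem_sup_right ?_)
  · exact Submodule.smul_mem _ _ (Submodule.mem_span_singleton_self 1)
  · exact Submodule.mem_iSup_of_mem 1 ⟨of.symm k, rfl⟩

/-! ### Existence of the rooted tree maps -/

/-- The rooted tree maps on the letter `z_s^δ`. -/
def onZdelta (s : rootsOfUnity r ℂ) : CK →ₗ[ℚ] NCPoly r :=
  LinearMap.mulLeft ℚ (Zdelta s) ∘ₗ (theta s).toLinearMap ∘ₗ of.symm.toLinearMap ∘ₗ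
    toDiamond.toLinearMap

variable (r) in
/-- The rooted tree maps on the letter `z`. -/
def onZ : CK →ₗ[ℚ] NCPoly r := LinearMap.toSpanSingleton ℚ (NCPoly r) Z ∘ₗ counitHom.toLinearMap

open Classical in
variable (r) in
/-- The rooted tree maps, as an algebra homomorphism to the convolution algebra. -/
def treeMapConv : NCPoly r →ₐ[ℚ] WithConv (CK →ₗ[ℚ] NCPoly r) :=
  FreeAlgebra.lift ℚ fun
    | .x => WithConv.toConv (onZdelta 1)
    | .y t => if t = 1 then WithConv.toConv (onZ r - onZdelta 1)
        else WithConv.toConv (onZdelta t - onZdelta 1)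

theorem treeMapConv_X : treeMapConv r X = WithConv.toConv (onZdelta 1) :=
  FreeAlgebra.lift_ι_apply _ _

open Classical in
theorem treeMapConv_Y (t : rootsOfUnity r ℂ) : treeMapConv r (Y t) =
    if t = 1 then WithConv.toConv (onZ r - onZdelta 1)
      else WithConv.toConv (onZdelta t - onZdelta 1) :=
  FreeAlgebra.lift_ι_apply _ _

theorem treeMapConv_Z : treeMapConv r Z = WithConv.toConv (onZ r) := by
  rw [Z, map_add, treeMapConv_X, treeMapConv_Y, if_pos rfl, ← WithConv.toConv_add,
    add_sub_cancel]

theorem treeMapConv_Zdelta (t : rootsOfUnity r ℂ) :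
    treeMapConv r (Zdelta t) = WithConv.toConv (onZdelta t) := by
  by_cases ht : t = 1
  · rw [ht, Zdelta_one, treeMapConv_X]
  · rw [Zdelta_of_ne ht, map_add, treeMapConv_X, treeMapConv_Y, if_neg ht,
      ← WithConv.toConv_add, add_sub_cancel]

variable (r) in
/-- The assignment of the rooted tree maps. -/
def treeMap : CK →ₗ[ℚ] Module.End ℚ (NCPoly r) :=
  LinearMap.flip
    ((WithConv.linearEquiv ℚ (CK →ₗ[ℚ] NCPoly r)).toLinearMap ∘ₗ (treeMapConv r).toLinearMap)

theorem treeMap_apply (a : CK) (w : NCPoly r) : treeMap r a w = (treeMapConv r w).ofConv a := rfl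

theorem treeMap_Z (a : CK) : treeMap r a Z = counitHom a • Z := by
  rw [treeMap_apply, treeMapConv_Z]; rfl

theorem treeMap_Zdelta (a : CK) (s : rootsOfUnity r ℂ) :
    treeMap r a (Zdelta s) = Zdelta s * theta s (of.symm (toDiamond a)) := by
  rw [treeMap_apply, treeMapConv_Zdelta]; rfl

theorem treeMap_mul (a : CK) (w v : NCPoly r) :
    treeMap r a (w * v) = LinearMap.mul' ℚ (NCPoly r)
      (TensorProduct.map ((treeMap r).flip w) ((treeMap r).flip v) (comulHom a)) := by
  rw [treeMap_apply, map_mul]; rfl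

theorem treeMap_one : treeMap r 1 = 1 := by
  refine LinearMap.ext fun w => ?_
  rw [Module.End.one_apply]
  have h1 : of.symm (toDiamond 1) = 1 := map_one toDiamond
  induction w using induction_zLetters with
  | one =>
    rw [treeMap_apply, map_one (treeMapConv r), LinearMap.convOne_apply,
      Bialgebra.counit_one, map_one]
  | add a b ha hb => rw [map_add, ha, hb]
  | smul c a ha => rw [map_smul, ha]
  | mul_Z a ha =>
    rw [treeMap_mul, map_one, Algebra.TensorProduct.one_def, TensorProduct.map_tmul,
      LinearMap.mul'_apply, LinearMap.flip_apply, LinearMap.flip_apply, treeMap_Z, ha, map_one,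
      one_smul]
  | mul_Zdelta t a ha =>
    rw [treeMap_mul, map_one, Algebra.TensorProduct.one_def, TensorProduct.map_tmul,
      LinearMap.mul'_apply, LinearMap.flip_apply, LinearMap.flip_apply, treeMap_Zdelta, ha,
      h1, map_one, mul_one]

/-- The rooted tree maps in terms of the diamond product. -/
theorem treeMap_Zdelta_mul (a : CK) (s : rootsOfUnity r ℂ) (w : NCPoly r) :
    treeMap r a (Zdelta s * w) = Zdelta s * diamond s (of.symm (toDiamond a)) w := by
  induction w using induction_zLetters generalizing a with
  | one => rw [mul_one, treeMap_Zdelta, diamond_one]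
  | add w w' h h' => simp only [mul_add, map_add, h, h']
  | smul c w h => simp only [mul_smul_comm, map_smul, h]
  | mul_Z w h =>
    have hz : (treeMap r).flip Z =
        LinearMap.toSpanSingleton ℚ (NCPoly r) Z ∘ₗ counitHom.toLinearMap :=
      LinearMap.ext treeMap_Z
    rw [← mul_assoc, treeMap_mul, hz, mul'_map_counit, LinearMap.flip_apply, h, diamond_mul_Z,
      mul_assoc]
  | mul_Zdelta t w h =>
    rw [← mul_assoc, treeMap_mul, diamond_mul_Zdelta, deconcat_toDiamond]
    generalize comulHom a = z
    induction z with
    | zero => simp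
    | add z z' h h' => simp only [map_add, mul_add, h, h']
    | tmul b c =>
      simp only [TensorProduct.map_tmul, LinearMap.mul'_apply, LinearMap.flip_apply, h,
        treeMap_Zdelta]
      simp [mul_assoc]

theorem isRootedTreeMap_treeMap : IsRootedTreeMap (treeMap r) where
  one := treeMap_one
  dot_Zdelta s := by
    rw [treeMap_Zdelta, toDiamond_tree_graft, forest_zero, map_one, graftOp_one,
      LinearEquiv.symm_apply_apply, theta_Y]
  dot_Z := by rw [treeMap_Z, counitHom_tree, zero_smul]
  graft_Zdelta f hf s := by
    obtain ⟨k, hk⟩ := toDiamond_sub_counit_mem (forest f)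
    rw [counitHom_forest hf, zero_smul, sub_zero] at hk
    refine ⟨Zdelta s * theta s (of.symm k), ?_, ?_⟩
    · rw [treeMap_Zdelta, ← hk, mul_assoc, ← theta_Y s 1, ← map_mul]
      rfl
    · have h2 : 2 * Z - Zdelta s = theta s (Z + Y 1) := by
        rw [map_add, theta_Z, theta_Y]
        noncomm_ring
      rw [treeMap_Zdelta, toDiamond_Bplus, ← hk, graftOp_concat_Y, h2, ← theta_Y s 1, mul_assoc,
        mul_assoc, ← map_mul, ← map_mul]
      rfl
  graft_Z f _ := by rw [treeMap_Z, counitHom_Bplus, zero_smul]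
  mul g h v hv := by
    rcases hv with rfl | ⟨s, rfl⟩
    · rw [treeMap_Z, treeMap_Z, map_smul, treeMap_Z, map_mul, smul_smul, mul_comm]
    · rw [treeMap_Zdelta, treeMap_Zdelta, treeMap_Zdelta_mul, diamond_theta, map_mul]
      rfl
  comul f w v _ := treeMap_mul (forest f) w v

/-! ### Uniqueness of the rooted tree maps -/

/-- The homomorphism `𝒜_r → ℚ` with `z ↦ 1` and `z_s^δ ↦ 0`. -/
def evalZ : NCPoly r →ₐ[ℚ] ℚ :=
  open Classical in
  FreeAlgebra.lift ℚ fun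
    | .x => 0
    | .y t => if t = 1 then 1 else 0

theorem evalZ_X : evalZ (r := r) X = 0 := FreeAlgebra.lift_ι_apply _ _

open Classical in
theorem evalZ_Y (t : rootsOfUnity r ℂ) : evalZ (Y t) = if t = 1 then 1 else 0 :=
  FreeAlgebra.lift_ι_apply _ _

theorem Z_sub_Zdelta_ne_zero (s : rootsOfUnity r ℂ) : Z - Zdelta s ≠ 0 := by
  intro h
  have h' := congrArg evalZ h
  by_cases hs : s = 1
  · simp [hs, Zdelta_one, Z, evalZ_Y] at h'
  · simp [Zdelta_of_ne hs, Z, evalZ_Y, hs] at h'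

theorem Z_ne_zero : (Z : NCPoly r) ≠ 0 := by
  intro h
  have h' := congrArg evalZ h
  simp [Z, evalZ_X, evalZ_Y] at h'

theorem Z_mem_zLetters : (Z : NCPoly r) ∈ zLetters r := Set.mem_insert _ _

theorem Zdelta_mem_zLetters (s : rootsOfUnity r ℂ) : Zdelta s ∈ zLetters r :=
  Set.mem_insert_of_mem _ ⟨s, rfl⟩

namespace IsRootedTreeMap

variable {T T' : CK →ₗ[ℚ] Module.End ℚ (NCPoly r)}

theorem apply_mul (hT : IsRootedTreeMap T) (a : CK) (w : NCPoly r) {v : NCPoly r}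
    (hv : v ∈ zLetters r) : T a (w * v) = LinearMap.mul' ℚ (NCPoly r)
      (TensorProduct.map (T.flip w) (T.flip v) (comulHom a)) := by
  induction a using induction_forest with
  | forest f => exact hT.comul f w v hv
  | add a b ha hb => simp only [map_add, LinearMap.add_apply, ha, hb]
  | smul c a ha => simp only [map_smul, LinearMap.smul_apply, ha]

theorem mul_apply (hT : IsRootedTreeMap T) (a b : CK) {v : NCPoly r} (hv : v ∈ zLetters r) :
    T (a * b) v = T a (T b v) := by
  induction a using induction_forest with
  | forest f =>
    induction b using induction_forest with
    | forest g => exact hT.mul f g v hv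
    | add a b ha hb => simp only [mul_add, map_add, LinearMap.add_apply, ha, hb]
    | smul c a ha => simp only [mul_smul_comm, map_smul, LinearMap.smul_apply, ha]
  | add a b ha hb => simp only [add_mul, map_add, LinearMap.add_apply, ha, hb]
  | smul c a ha => simp only [smul_mul_assoc, map_smul, LinearMap.smul_apply, ha]

theorem tree_Z (hT : IsRootedTreeMap T) (t : RootedTree) : T (tree t) Z = 0 := by
  rw [← graft_branches t]
  by_cases h : branches t = 0
  · rw [h, hT.dot_Z]
  · rw [← Bplus_forest, hT.graft_Z _ h]

theorem apply_Z (hT : IsRootedTreeMap T) (a : CK) : T a Z = counitHom a • Z := by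
  induction a using induction_forest with
  | forest f =>
    induction f using Multiset.induction_on with
    | empty => rw [forest_zero, hT.one, map_one, one_smul, Module.End.one_apply]
    | cons t f ih =>
      rw [forest_cons, hT.mul_apply _ _ Z_mem_zLetters, ih, map_smul, hT.tree_Z, map_mul,
        counitHom_tree, zero_mul, zero_smul, smul_zero]
  | add a b ha hb => rw [map_add, LinearMap.add_apply, ha, hb, map_add, add_smul]
  | smul c a ha => rw [map_smul, LinearMap.smul_apply, ha, map_smul, smul_assoc]

theorem apply_one (hT : IsRootedTreeMap T) (a : CK) : T a 1 = counitHom a • 1 := by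
  have h := hT.apply_mul a 1 Z_mem_zLetters
  have hz : T.flip Z = LinearMap.toSpanSingleton ℚ (NCPoly r) Z ∘ₗ counitHom.toLinearMap :=
    LinearMap.ext hT.apply_Z
  rw [hz, mul'_map_counit, one_mul, hT.apply_Z, LinearMap.flip_apply] at h
  refine mul_right_cancel₀ Z_ne_zero ?_
  rw [← h, smul_mul_assoc, one_mul]

theorem exists_apply_Zdelta (hT : IsRootedTreeMap T) (a : CK) (s : rootsOfUnity r ℂ) :
    ∃ u, T a (Zdelta s) = counitHom a • Zdelta s + u * (Z - Zdelta s) ∧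
      T (Bplus a) (Zdelta s) = counitHom a • (Zdelta s * (Z - Zdelta s)) +
        u * (2 * Z - Zdelta s) * (Z - Zdelta s) := by
  induction a using induction_forest with
  | forest f =>
    by_cases hf : f = 0
    · refine ⟨0, ?_, ?_⟩
      · rw [hf, forest_zero, hT.one]
        simp
      · rw [Bplus_forest, hf, hT.dot_Zdelta, forest_zero]
        simp
    · obtain ⟨u, hu, hu'⟩ := hT.graft_Zdelta f hf s
      exact ⟨u, by rw [hu, counitHom_forest hf, zero_smul, zero_add],
        by rw [hu', counitHom_forest hf, zero_smul, zero_add]⟩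
  | add a b ha hb =>
    obtain ⟨u, hu, hu'⟩ := ha
    obtain ⟨v, hv, hv'⟩ := hb
    refine ⟨u + v, ?_, ?_⟩
    · simp only [map_add, LinearMap.add_apply, hu, hv, add_smul, add_mul]
      abel
    · simp only [map_add, LinearMap.add_apply, hu', hv', add_smul, add_mul]
      abel
  | smul c a ha =>
    obtain ⟨u, hu, hu'⟩ := ha
    refine ⟨c • u, ?_, ?_⟩
    · simp only [map_smul, LinearMap.smul_apply, hu, smul_add, smul_mul_assoc, smul_assoc]
    · simp only [map_smul, LinearMap.smul_apply, hu', smul_add, smul_mul_assoc, smul_assoc]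

theorem Bplus_Zdelta_congr (hT : IsRootedTreeMap T) (hT' : IsRootedTreeMap T') {a : CK}
    {s : rootsOfUnity r ℂ} (h : T a (Zdelta s) = T' a (Zdelta s)) :
    T (Bplus a) (Zdelta s) = T' (Bplus a) (Zdelta s) := by
  obtain ⟨u, hu, hu'⟩ := hT.exists_apply_Zdelta a s
  obtain ⟨v, hv, hv'⟩ := hT'.exists_apply_Zdelta a s
  rw [hu, hv, add_left_cancel_iff] at h
  rw [hu', hv', mul_right_cancel₀ (Z_sub_Zdelta_ne_zero s) h]

end IsRootedTreeMap

/-- The span of the tensors `a ⊗ b` with `a` in `C` and `b` in `D`. -/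
abbrev tensorSpan (C D : Submodule ℚ CK) : Submodule ℚ (CK ⊗[ℚ] CK) :=
  Submodule.map₂ (TensorProduct.mk ℚ CK CK) C D

theorem mul_mem_tensorSpan {C D : Submodule ℚ CK} {x y : CK ⊗[ℚ] CK}
    (hx : x ∈ tensorSpan C C) (hy : y ∈ tensorSpan D D) :
    x * y ∈ tensorSpan (C * D) (C * D) := by
  have h : tensorSpan C C ≤
      (tensorSpan (C * D) (C * D)).comap (LinearMap.mulRight ℚ y) := by
    refine Submodule.map₂_le.2 fun a ha b hb => ?_
    have h' : tensorSpan D D ≤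
        (tensorSpan (C * D) (C * D)).comap (LinearMap.mulLeft ℚ (a ⊗ₜ[ℚ] b)) := by
      refine Submodule.map₂_le.2 fun c hc d hd => ?_
      rw [Submodule.mem_comap, LinearMap.mulLeft_apply, TensorProduct.mk_apply,
        Algebra.TensorProduct.tmul_mul_tmul]
      exact Submodule.apply_mem_map₂ _ (Submodule.mul_mem_mul ha hc)
        (Submodule.mul_mem_mul hb hd)
    exact h' hy
  exact h hx

/-- `C` is a subcoalgebra. -/
def IsSubcoalgebra (C : Submodule ℚ CK) : Prop := ∀ c ∈ C, comulHom c ∈ tensorSpan C C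

theorem IsSubcoalgebra.mul {C D : Submodule ℚ CK} (hC : IsSubcoalgebra C)
    (hD : IsSubcoalgebra D) : IsSubcoalgebra (C * D) := by
  have h : C * D ≤ (tensorSpan (C * D) (C * D)).comap comulHom.toLinearMap := by
    refine Submodule.mul_le.2 fun c hc d hd => ?_
    rw [Submodule.mem_comap, AlgHom.toLinearMap_apply, map_mul]
    exact mul_mem_tensorSpan (hC c hc) (hD d hd)
  exact fun c hc => h hc

theorem isSubcoalgebra_one : IsSubcoalgebra 1 := by
  have h : (1 : Submodule ℚ CK) ≤ (tensorSpan 1 1).comap comulHom.toLinearMap := by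
    rw [Submodule.one_le, Submodule.mem_comap, AlgHom.toLinearMap_apply, map_one]
    exact Submodule.apply_mem_map₂ _ (Submodule.one_le.1 le_rfl) (Submodule.one_le.1 le_rfl)
  exact fun c hc => h hc

theorem IsSubcoalgebra.sup_map_Bplus {C : Submodule ℚ CK} (hC : IsSubcoalgebra C) :
    IsSubcoalgebra (1 ⊔ (C ⊔ C.map Bplus)) := by
  set D := 1 ⊔ (C ⊔ C.map Bplus)
  have h1 : 1 ≤ D := le_sup_left
  have hCD : C ≤ D := le_sup_left.trans le_sup_right
  have hBD : C.map Bplus ≤ D := le_sup_right.trans le_sup_right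
  have h : D ≤ (tensorSpan D D).comap comulHom.toLinearMap := by
    refine sup_le (fun c hc => ?_) (sup_le (fun c hc => ?_) ?_)
    · exact Submodule.map₂_le_map₂ h1 h1 (isSubcoalgebra_one c hc)
    · exact Submodule.map₂_le_map₂ hCD hCD (hC c hc)
    · rintro _ ⟨c, hc, rfl⟩
      rw [Submodule.mem_comap, AlgHom.toLinearMap_apply, comulHom_Bplus]
      refine add_mem (Submodule.apply_mem_map₂ _ (hBD ⟨c, hc, rfl⟩)
        (h1 (Submodule.one_le.1 le_rfl))) ?_
      have h' : tensorSpan C C ≤ (tensorSpan D D).comap (Bplus.lTensor CK) := by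
        refine Submodule.map₂_le.2 fun a ha b hb => ?_
        exact Submodule.apply_mem_map₂ _ (hCD ha) (hBD ⟨b, hb, rfl⟩)
      exact h' (hC c hc)
  exact fun c hc => h hc

namespace IsRootedTreeMap

variable {T T' : CK →ₗ[ℚ] Module.End ℚ (NCPoly r)}

/-- On a subcoalgebra, rooted tree maps are determined by their values on letters. -/
theorem eqOn_of_eqOn_zLetters (hT : IsRootedTreeMap T) (hT' : IsRootedTreeMap T')
    {C : Submodule ℚ CK} (hC : IsSubcoalgebra C)
    (h : ∀ v ∈ zLetters r, ∀ c ∈ C, T c v = T' c v) : ∀ c ∈ C, T c = T' c := by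
  have key : ∀ (w : NCPoly r), ∀ c ∈ C, T c w = T' c w := by
    intro w
    have step : ∀ w : NCPoly r, (∀ c ∈ C, T c w = T' c w) → ∀ v ∈ zLetters r,
        ∀ c ∈ C, T c (w * v) = T' c (w * v) := by
      intro w hw v hv c hc
      rw [hT.apply_mul c w hv, hT'.apply_mul c w hv]
      have h' : tensorSpan C C ≤ LinearMap.eqLocus
          (TensorProduct.map (T.flip w) (T.flip v))
          (TensorProduct.map (T'.flip w) (T'.flip v)) := by
        refine Submodule.map₂_le.2 fun a ha b hb => ?_
        rw [LinearMap.mem_eqLocus, TensorProduct.mk_apply, TensorProduct.map_tmul,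
          TensorProduct.map_tmul]
        simp only [LinearMap.flip_apply]
        rw [hw a ha, h v hv b hb]
      exact congrArg _ (h' (hC c hc))
    induction w using induction_zLetters with
    | one => intro c _; rw [hT.apply_one, hT'.apply_one]
    | add a b ha hb => intro c hc; rw [map_add, map_add, ha c hc, hb c hc]
    | smul q a ha => intro c hc; rw [map_smul, map_smul, ha c hc]
    | mul_Z a ha => exact step a ha Z Z_mem_zLetters
    | mul_Zdelta t a ha => exact step a ha _ (Zdelta_mem_zLetters t)
  exact fun c hc => LinearMap.ext fun w => key w c hc

theorem exists_subcoalgebra_forest (hT : IsRootedTreeMap T) (hT' : IsRootedTreeMap T')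
    (f : Multiset RootedTree)
    (hf : ∀ t ∈ f, ∃ C, IsSubcoalgebra C ∧ tree t ∈ C ∧ ∀ c ∈ C, T c = T' c) :
    ∃ C, IsSubcoalgebra C ∧ forest f ∈ C ∧ ∀ c ∈ C, T c = T' c := by
  induction f using Multiset.induction_on with
  | empty =>
    refine ⟨1, isSubcoalgebra_one, Submodule.one_le.1 le_rfl, ?_⟩
    have h : (1 : Submodule ℚ CK) ≤ LinearMap.eqLocus T T' := by
      rw [Submodule.one_le, LinearMap.mem_eqLocus, hT.one, hT'.one]
    exact fun c hc => h hc
  | cons t f ih =>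
    obtain ⟨C, hC, htC, hCT⟩ := hf t (Multiset.mem_cons_self t f)
    obtain ⟨D, hD, hfD, hDT⟩ := ih fun u hu => hf u (Multiset.mem_cons_of_mem hu)
    refine ⟨C * D, hC.mul hD, forest_cons t f ▸ Submodule.mul_mem_mul htC hfD, ?_⟩
    refine hT.eqOn_of_eqOn_zLetters hT' (hC.mul hD) fun v hv => ?_
    have h : C * D ≤ LinearMap.eqLocus (T.flip v) (T'.flip v) := by
      refine Submodule.mul_le.2 fun c hc d hd => ?_
      rw [LinearMap.mem_eqLocus, LinearMap.flip_apply, LinearMap.flip_apply,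
        hT.mul_apply c d hv, hT'.mul_apply c d hv, hDT d hd, hCT c hc]
    exact fun c hc => h hc

theorem exists_subcoalgebra_tree (hT : IsRootedTreeMap T) (hT' : IsRootedTreeMap T')
    (t : RootedTree) : ∃ C, IsSubcoalgebra C ∧ tree t ∈ C ∧ ∀ c ∈ C, T c = T' c := by
  induction t using RootedTree.induction with
  | h f ih =>
    obtain ⟨C, hC, hfC, hCT⟩ := hT.exists_subcoalgebra_forest hT' f ih
    refine ⟨_, hC.sup_map_Bplus, ?_, ?_⟩
    · exact Submodule.mem_sup_right (Submodule.mem_sup_right ⟨_, hfC, Bplus_forest f⟩)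
    · refine hT.eqOn_of_eqOn_zLetters hT' hC.sup_map_Bplus fun v hv => ?_
      have h : 1 ⊔ (C ⊔ C.map Bplus) ≤ LinearMap.eqLocus (T.flip v) (T'.flip v) := by
        refine sup_le ?_ (sup_le (fun c hc => ?_) ?_)
        · rw [Submodule.one_le, LinearMap.mem_eqLocus, LinearMap.flip_apply,
            LinearMap.flip_apply, hT.one, hT'.one]
        · rw [LinearMap.mem_eqLocus, LinearMap.flip_apply, LinearMap.flip_apply, hCT c hc]
        · rintro _ ⟨c, hc, rfl⟩
          rw [LinearMap.mem_eqLocus, LinearMap.flip_apply, LinearMap.flip_apply]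
          rcases hv with rfl | ⟨s, rfl⟩
          · rw [hT.apply_Z, hT'.apply_Z]
          · exact hT.Bplus_Zdelta_congr hT' (by rw [hCT c hc])
      exact fun c hc => h hc

theorem eq (hT : IsRootedTreeMap T) (hT' : IsRootedTreeMap T') : T = T' := by
  refine forestBasis.ext fun f => ?_
  obtain ⟨C, -, hfC, hCT⟩ := hT.exists_subcoalgebra_forest hT' f fun t _ =>
    hT.exists_subcoalgebra_tree hT' t
  rw [forestBasis_apply]
  exact hCT _ hfC

end IsRootedTreeMap

/-! ### Uniqueness of the elements that represent the rooted tree maps -/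

/-- The retraction of `𝒜_r` to `𝒜_1` that kills `y_s` for `s ≠ 1`. -/
def retract : NCPoly r →ₐ[ℚ] NCPoly 1 :=
  open Classical in
  FreeAlgebra.lift ℚ fun
    | .x => X
    | .y t => if t = 1 then Y 1 else 0

theorem retract_X : retract (r := r) X = X := FreeAlgebra.lift_ι_apply _ _

theorem retract_Y_one : retract (r := r) (Y 1) = Y 1 :=
  (FreeAlgebra.lift_ι_apply _ _).trans (if_pos rfl)

theorem incl_injective : Function.Injective (incl (r := r)) := by
  have h : retract.comp (incl (r := r)) = AlgHom.id ℚ (NCPoly 1) := by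
    refine ncpoly_algHom_ext ?_ fun t => ?_
    · simp [incl_X, retract_X]
    · simp [incl_Y, retract_Y_one, root_eq_one t]
  exact Function.LeftInverse.injective fun v => DFunLike.congr_fun h v

theorem X_ne_zero : (X : NCPoly r) ≠ 0 := FreeAlgebra.ι_ne_zero _

theorem eq_of_Zdelta_mul_diamond_eq {G G' : NCPoly 1}
    (h : ∀ (s : rootsOfUnity r ℂ) (w : NCPoly r),
      Zdelta s * diamond s G w = Zdelta s * diamond s G' w) : G = G' := by
  have h1 := h 1 1
  rw [Zdelta_one, diamond_one, diamond_one, theta_one_root_eq_incl] at h1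
  exact incl_injective (mul_left_cancel₀ X_ne_zero h1)

end

end RootedTreeMaps

theorem theorem2p2 (r : ℕ) (hr : 1 ≤ r) :
    (∃! T : CK →ₗ[ℚ] Module.End ℚ (NCPoly r), IsRootedTreeMap T) ∧
    ∀ T : CK →ₗ[ℚ] Module.End ℚ (NCPoly r), IsRootedTreeMap T →
      ∀ f : CK, ∃! G : NCPoly 1, G ∈ A1 1 ∧
        ∀ (s : rootsOfUnity r ℂ) (w : NCPoly r),
          T (HopfAlgebra.antipode ℚ f) (Zdelta s * w) = Zdelta s * diamond s G w := by
  refine ⟨⟨treeMap r, isRootedTreeMap_treeMap, fun T hT => hT.eq isRootedTreeMap_treeMap⟩,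
    fun T hT f => ?_⟩
  rw [hT.eq isRootedTreeMap_treeMap]
  refine ⟨DiamondAlg.of.symm (toDiamond (HopfAlgebra.antipode ℚ f)),
    ⟨toDiamond_mem_A1 _, fun s w => treeMap_Zdelta_mul _ s w⟩, ?_⟩
  rintro G ⟨-, hG⟩
  refine eq_of_Zdelta_mul_diamond_eq (r := r) fun s w => ?_
  rw [← hG, treeMap_Zdelta_mul]
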